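/- Let $K_n$ be the complete directed graph (without self-loops) on $n$ vertices, whose $n(n-1)$ edges $u\to v$ carry independent weights $W(u,v)$, each uniformly distributed on $[0,1]$. Paths have distinct vertices, and the length of a path is the sum of the weights of its edges. For vertices $u,v$, a path from $u$ to $v$ is a \emph{shortest path} if no path from $u$ to $v$ has smaller length (the empty path from $u$ to $u$ is a shortest path), $D(u,v)$ denotes the length of a shortest path from $u$ to $v$, and $u\rightsquigarrow v$ denotes a shortest path from $u$ to $v$ (unique with probability $1$). A path with at least one edge is a \emph{locally shortest path} (LSP) if the path obtained by deleting its first edge and the path obtained by deleting its last edge are both shortest paths (in particular, each single edge is an LSP). Let $\mathcal{LSP}$ be the (random) set of all LSPs in $K_n$. Then: 1. $\mathbb{E}\bigl[|\mathcal{LSP}|\bigr]=\Theta(n^2)$ as $n\to\infty$. 2. There is an absolute constant $C_1$ such that, for every $n$ and all distinct vertices $a,b,c$ of $K_n$, the path $a\to b\to c$ is an LSP with probability at most $C_1\ln^2 n/n^2$. 3. There is an absolute constant $C_2$ such that, for every $n$ and all distinct vertices $a,b,c,d$ of $K_n$, the probability that $a\to b\rightsquigarrow c\to d$ is an LSP for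 some shortest path $b\rightsquigarrow c$ is at most $C_2/n^2$. 4. There is an absolute constant $C_3$ such that, for every $n$ and all distinct vertices $a,b$ of $K_n$, $D(a,b)$ is square-integrable and $\mathrm{Var}[D(a,b)]\le C_3/n^2$. -/

import Mathlib

open MeasureTheory ProbabilityTheory Filter Asymptotics

namespace RandomAPSP

/-- The edges of the complete directed graph on the vertex set `Fin n` (no self-loops). -/
abbrev Edge (n : ℕ) : Type := {e : Fin n × Fin n // e.1 ≠ e.2}

/-- The law of the edge weights: independent weights, each uniform on `[0,1]`. -/
noncomputable def uniformWeights (n : ℕ) : Measure (Edge n → ℝ) :=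
  Measure.pi fun _ => (volume : Measure ℝ).restrict (Set.Icc 0 1)

instance uniformWeights_isProbabilityMeasure (n : ℕ) :
    IsProbabilityMeasure (uniformWeights n) := by
  have : IsProbabilityMeasure ((volume : Measure ℝ).restrict (Set.Icc 0 1)) :=
    ⟨by simp⟩
  unfold uniformWeights
  infer_instance

/-- The weight of the edge from `u` to `v`. The value for `u = v` is never used, because paths
do not repeat vertices. -/
def edgeWeight {n : ℕ} (w : Edge n → ℝ) (u v : Fin n) : ℝ :=
  if h : u ≠ v then w ⟨(u, v), h⟩ else 0

/-- The length (sum of the edge weights) of the path with the given sequence of vertices. -/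
def pathLength {n : ℕ} (w : Edge n → ℝ) : List (Fin n) → ℝ
  | [] => 0
  | [_] => 0
  | u :: v :: p => edgeWeight w u v + pathLength w (v :: p)

/-- `p` is the vertex sequence of a directed path from `u` to `v`. The vertices of a path are
distinct; `[u]` is the empty path at `u`. -/
def IsPath {n : ℕ} (u v : Fin n) (p : List (Fin n)) : Prop :=
  p.head? = some u ∧ p.getLast? = some v ∧ p.Nodup

/-- `p` is a shortest path from `u` to `v`. -/
def IsShortestPath {n : ℕ} (w : Edge n → ℝ) (u v : Fin n) (p : List (Fin n)) : Prop :=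
  IsPath u v p ∧ ∀ q : List (Fin n), IsPath u v q → pathLength w p ≤ pathLength w q

/-- `p` is a locally shortest path: a path with at least one edge such that deleting its first
edge and deleting its last edge both leave a shortest path (between the remaining endpoints). -/
def IsLSP {n : ℕ} (w : Edge n → ℝ) (p : List (Fin n)) : Prop :=
  p.Nodup ∧ 2 ≤ p.length ∧
    (∃ u v : Fin n, IsShortestPath w u v p.tail) ∧
    (∃ u v : Fin n, IsShortestPath w u v p.dropLast)

/-- The set of all locally shortest paths. -/
def lspSet {n : ℕ} (w : Edge n → ℝ) : Set (List (Fin n)) := {p | IsLSP w p}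

/-- The number of locally shortest paths (the set is finite, see `lspSet_finite`). -/
noncomputable def lspCount {n : ℕ} (w : Edge n → ℝ) : ℕ := (lspSet w).ncard

/-- The distance from `u` to `v`: the least length of a path from `u` to `v`
(attained, see `distance_isLeast`). -/
noncomputable def distance {n : ℕ} (w : Edge n → ℝ) (u v : Fin n) : ℝ :=
  sInf {x : ℝ | ∃ p : List (Fin n), IsPath u v p ∧ pathLength w p = x}

/-- The event that the path `a → b ⇝ c → d` is locally shortest, where `b ⇝ c` is a shortest
path from `b` to `c`. -/
def IsLSPVia {n : ℕ} (w : Edge n → ℝ) (a b c d : Fin n) : Prop :=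
  ∃ p : List (Fin n), IsShortestPath w b c p ∧ IsLSP w (a :: p ++ [d])

theorem nodup_finite (n : ℕ) : {p : List (Fin n) | p.Nodup}.Finite := by
  refine (List.finite_length_le (Fin n) n).subset fun p hp => ?_
  simpa using List.Nodup.length_le_card (α := Fin n) hp

theorem lspSet_finite {n : ℕ} (w : Edge n → ℝ) : (lspSet w).Finite :=
  (nodup_finite n).subset fun _ h => h.1

theorem exists_isPath {n : ℕ} (u v : Fin n) : ∃ p : List (Fin n), IsPath u v p := by
  by_cases h : u = v
  · exact ⟨[u], by simp [IsPath, h]⟩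
  · exact ⟨[u, v], by simp [IsPath, h]⟩

theorem distance_isLeast {n : ℕ} (w : Edge n → ℝ) (u v : Fin n) :
    IsLeast {x : ℝ | ∃ p : List (Fin n), IsPath u v p ∧ pathLength w p = x}
      (distance w u v) := by
  have hfin : {x : ℝ | ∃ p : List (Fin n), IsPath u v p ∧ pathLength w p = x}.Finite :=
    (((nodup_finite n).subset fun _ h => h.2.2).image (pathLength w) :
      ((pathLength w) '' {p | IsPath u v p}).Finite)
  obtain ⟨p, hp⟩ := exists_isPath u v
  have hne : {x : ℝ | ∃ p : List (Fin n), IsPath u v p ∧ pathLength w p = x}.Nonempty :=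
    ⟨_, p, hp, rfl⟩
  exact ⟨hne.csInf_mem hfin, fun x hx => csInf_le hfin.bddBelow hx⟩

end RandomAPSP

/-! Take independent exponential weights `x` of rate one. The weights `1 - exp (-x)` are uniform, so
both models live on one probability space, and distances are analysed first in the exponential one.

Let `S` be a set of vertices not containing `b`, let `r` be the number of vertices outside `S`, and
let `D` be the distance from `S` to `b`. An exponential variable satisfies `E f(X) = f(0) + E
f'(X)`. As a function of the weight `y` of one edge leaving `S`, `D` has the form `min A (y + B)`.
Hence `f = D ^ j` has derivative `j * D ^ (j - 1)` where that edge is the first edge of the optimal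
path, and zero elsewhere. At `y = 0` the endpoint of the edge is absorbed into `S`. Almost surely
exactly one edge leaving `S` is the first edge, so summing over these edges gives the closed
recursion `setDist_moment_recursion`. Its solution `momentSeq` depends only on `n`, `j` and `r`.
Elementary estimates of it give variance `O(1/n²)` (`momentSeq_variance_le`) and fourth moment
`O((log n / n)⁴)` (`momentSeq_four_le`).

Passing to uniform weights lowers a distance `D` by at most `D²`. The fourth moment controls this
error in mean square, so all uniform distances lie within `O(1/n)`, in `L²`, of one common constant
`m` (`exists_lintegral_uniform_distance_sub_sq_le`). This gives the variance bound.

If `a → b → c` is an LSP, then `W(a,b) ≤ D(a,b)` and `W(b,c) ≤ D(b,c)`. If `a → b ⇝ c → d` is one,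
then `W(a,b) ≤ D(a,c) - D(b,c)` and `W(c,d) ≤ D(b,d) - D(b,c)`. Raising the two edges to weight one
keeps these inequalities and makes their right sides independent of the two edge weights, so the
probability is at most the expected product of the right sides (`uniformWeights_two_edges_le`).
Distances are of order `log n / n`, while their differences are only of order `1/n` because of the
common centre `m`.

For the count, shortest paths are almost surely unique, so an LSP with at least three edges is
determined by its first two and last two vertices. The expected number is at most of order `n² + n³
· log² n / n² + n⁴ / n²`. Single edges give the lower bound. -/

namespace RandomAPSP

/-! ### Deterministic facts about paths, distances and changes of one edge weight. -/

section Paths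

variable {n : ℕ}

theorem edgeWeight_of_ne (w : Edge n → ℝ) {u v : Fin n} (h : u ≠ v) :
    edgeWeight w u v = w ⟨(u, v), h⟩ := dif_pos h

theorem edgeWeight_nonneg {w : Edge n → ℝ} (h : ∀ e, 0 ≤ w e) (u v : Fin n) :
    0 ≤ edgeWeight w u v := by
  unfold edgeWeight; split_ifs
  · exact h _
  · exact le_rfl

theorem edgeWeight_le_mul {w w' : Edge n → ℝ} {r : ℝ} (h : ∀ e, w' e ≤ r * w e) (u v : Fin n) :
    edgeWeight w' u v ≤ r * edgeWeight w u v := by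
  unfold edgeWeight; split_ifs
  · exact h _
  · simp

theorem edgeWeight_update_self (w : Edge n → ℝ) (e : Edge n) (y : ℝ) :
    edgeWeight (Function.update w e y) e.1.1 e.1.2 = y := by
  rw [edgeWeight_of_ne _ e.2]; simp

theorem edgeWeight_update_of_ne (w : Edge n → ℝ) {e : Edge n} {u v : Fin n} (y : ℝ)
    (h : (u, v) ≠ e.1) : edgeWeight (Function.update w e y) u v = edgeWeight w u v := by
  unfold edgeWeight; split_ifs with h'
  · rw [Function.update_of_ne]
    exact fun h0 => h (congrArg Subtype.val h0)
  · rfl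

theorem pathLength_cons_cons (w : Edge n → ℝ) (u v : Fin n) (p : List (Fin n)) :
    pathLength w (u :: v :: p) = edgeWeight w u v + pathLength w (v :: p) := rfl

theorem pathLength_nonneg {w : Edge n → ℝ} (h : ∀ e, 0 ≤ w e) :
    ∀ p : List (Fin n), 0 ≤ pathLength w p
  | [] => le_rfl
  | [_] => le_rfl
  | u :: v :: p => add_nonneg (edgeWeight_nonneg h u v) (pathLength_nonneg h (v :: p))

theorem pathLength_le_mul {w w' : Edge n → ℝ} {r : ℝ} (h : ∀ e, w' e ≤ r * w e) :
    ∀ p : List (Fin n), pathLength w' p ≤ r * pathLength w p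
  | [] => by simp [pathLength]
  | [_] => by simp [pathLength]
  | u :: v :: p => by
    rw [pathLength_cons_cons, pathLength_cons_cons, mul_add]
    exact add_le_add (edgeWeight_le_mul h u v) (pathLength_le_mul h (v :: p))

theorem pathLength_congr {w w' : Edge n → ℝ} :
    ∀ p : List (Fin n), (∀ u v, [u, v] <:+: p → edgeWeight w u v = edgeWeight w' u v) →
      pathLength w p = pathLength w' p
  | [], _ => rfl
  | [_], _ => rfl
  | u :: v :: p, h => by
    rw [pathLength_cons_cons, pathLength_cons_cons, h u v ⟨[], p, rfl⟩,
      pathLength_congr (v :: p) fun a b hab => h a b (hab.trans (List.suffix_cons u _).isInfix)]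

theorem edgeWeight_le_pathLength {w : Edge n → ℝ} (h : ∀ e, 0 ≤ w e) {u v : Fin n} :
    ∀ p : List (Fin n), [u, v] <:+: p → edgeWeight w u v ≤ pathLength w p
  | [], hp => by simp at hp
  | [_], hp => by have := hp.length_le; simp at this
  | a :: b :: p, hp => by
    rw [pathLength_cons_cons]
    rcases List.infix_cons_iff.1 hp with h1 | h1
    · simp only [List.cons_prefix_cons, List.nil_prefix, and_true] at h1
      rw [h1.1, h1.2]
      linarith [pathLength_nonneg h (b :: p)]
    · linarith [edgeWeight_le_pathLength h (b :: p) h1, edgeWeight_nonneg h a b]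

theorem pathLength_append_singleton (w : Edge n → ℝ) (c d : Fin n) :
    ∀ p : List (Fin n), p.getLast? = some c →
      pathLength w (p ++ [d]) = pathLength w p + edgeWeight w c d
  | [], h => by simp at h
  | [u], h => by
    obtain rfl : u = c := by simpa using h
    simp [pathLength]
  | u :: v :: p, h => by
    have := pathLength_append_singleton w c d (v :: p) (by simpa using h)
    simp only [List.cons_append, pathLength_cons_cons] at this ⊢
    linarith

theorem pathLength_cons_of_head? (w : Edge n → ℝ) (a b : Fin n) {p : List (Fin n)}
    (h : p.head? = some b) : pathLength w (a :: p) = edgeWeight w a b + pathLength w p := by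
  cases p with
  | nil => simp at h
  | cons u p =>
    obtain rfl : u = b := by simpa using h
    rfl

theorem distance_le_pathLength (w : Edge n → ℝ) {u v : Fin n} {p : List (Fin n)}
    (hp : IsPath u v p) : distance w u v ≤ pathLength w p :=
  (distance_isLeast w u v).2 ⟨p, hp, rfl⟩

theorem exists_isPath_pathLength_eq (w : Edge n → ℝ) (u v : Fin n) :
    ∃ p, IsPath u v p ∧ pathLength w p = distance w u v :=
  (distance_isLeast w u v).1

theorem IsShortestPath.pathLength_eq {w : Edge n → ℝ} {u v : Fin n} {p : List (Fin n)}
    (hp : IsShortestPath w u v p) : pathLength w p = distance w u v := by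
  obtain ⟨q, hq, h⟩ := exists_isPath_pathLength_eq w u v
  exact le_antisymm (h ▸ hp.2 q hq) (distance_le_pathLength w hp.1)

theorem distance_nonneg {w : Edge n → ℝ} (h : ∀ e, 0 ≤ w e) (u v : Fin n) :
    0 ≤ distance w u v := by
  obtain ⟨q, -, hq⟩ := exists_isPath_pathLength_eq w u v
  exact hq ▸ pathLength_nonneg h q

theorem distance_le_mul {w w' : Edge n → ℝ} {r : ℝ} (h : ∀ e, w' e ≤ r * w e) (u v : Fin n) :
    distance w' u v ≤ r * distance w u v := by
  obtain ⟨q, h1, hq⟩ := exists_isPath_pathLength_eq w u v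
  exact hq ▸ (distance_le_pathLength w' h1).trans (pathLength_le_mul h q)

theorem distance_mono {w w' : Edge n → ℝ} (h : ∀ e, w' e ≤ w e) (u v : Fin n) :
    distance w' u v ≤ distance w u v := by
  simpa using distance_le_mul (r := 1) (by simpa using h) u v

theorem distance_le_edge (w : Edge n → ℝ) {u v : Fin n} (h : u ≠ v) :
    distance w u v ≤ w ⟨(u, v), h⟩ := by
  refine (distance_le_pathLength w (p := [u, v]) (by simp [IsPath, h])).trans ?_
  simp [pathLength, edgeWeight_of_ne w h]

theorem IsPath.not_infix_head {u v a : Fin n} {p : List (Fin n)} (hp : IsPath u v p) :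
    ¬ [a, u] <:+: p := by
  rintro ⟨s, t, rfl⟩
  obtain ⟨h1, -, h3⟩ := hp
  cases s with
  | nil =>
    simp at h1
    simp [h1] at h3
  | cons x s =>
    simp at h1
    simp [h1] at h3

theorem IsPath.not_infix_last {u v a : Fin n} {p : List (Fin n)} (hp : IsPath u v p) :
    ¬ [v, a] <:+: p := by
  rintro ⟨s, t, rfl⟩
  obtain ⟨-, h2, h3⟩ := hp
  rcases List.eq_nil_or_concat' t with rfl | ⟨t, x, rfl⟩
  · have h2' : a = v := by simpa using h2
    subst h2'
    simp [List.nodup_append] at h3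
  · have h2' : x = v := by
      rw [← List.append_assoc, List.getLast?_concat] at h2
      simpa using h2
    subst h2'
    simp [List.nodup_append] at h3

/-- Distinct paths with the same endpoints differ in an edge of the first one. -/
theorem exists_infix_of_ne {p q : List (Fin n)} (hp : p.Nodup) (hq : q.Nodup) {v : Fin n}
    (hpv : p.getLast? = some v) (hqv : q.getLast? = some v) (hh : p.head? = q.head?)
    (hne : p ≠ q) : ∃ a b, [a, b] <:+: p ∧ ¬ [a, b] <:+: q := by
  induction p generalizing q with
  | nil => simp at hpv
  | cons x p ih =>
    cases q with
    | nil => simp at hqv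
    | cons y q =>
      obtain rfl : x = y := by simpa using hh
      cases p with
      | nil =>
        exfalso
        obtain rfl : x = v := by simpa using hpv
        cases q with
        | nil => exact hne rfl
        | cons z q =>
          have : x ∈ z :: q := List.mem_of_getLast? (by simpa using hqv)
          exact (List.nodup_cons.1 hq).1 this
      | cons z p =>
        have hx : x ∉ z :: p := (List.nodup_cons.1 hp).1
        have hx' : x ∉ q := (List.nodup_cons.1 hq).1
        cases q with
        | nil =>
          refine ⟨x, z, ⟨[], p, rfl⟩, fun h => ?_⟩
          have := h.length_le
          simp at this
        | cons z' q =>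
          by_cases hz : z = z'
          · subst hz
            obtain ⟨a, b, h1, h2⟩ := ih (List.nodup_cons.1 hp).2 (List.nodup_cons.1 hq).2
              (by simpa using hpv) (by simpa using hqv) rfl (fun h => hne (by rw [h]))
            refine ⟨a, b, h1.trans (List.suffix_cons x _).isInfix, fun h => ?_⟩
            rcases List.infix_cons_iff.1 h with h3 | h3
            · simp only [List.cons_prefix_cons, List.nil_prefix, and_true] at h3
              exact hx (h3.1 ▸ h1.subset (by simp))
            · exact h2 h3
          · refine ⟨x, z, ⟨[], p, rfl⟩, fun h => ?_⟩
            rcases List.infix_cons_iff.1 h with h3 | h3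
            · simp only [List.cons_prefix_cons, List.nil_prefix, and_true] at h3
              exact hz h3.2
            · exact hx' (h3.subset (by simp))

theorem pathLength_update_of_not_infix (w : Edge n → ℝ) {e : Edge n} (y : ℝ) {p : List (Fin n)}
    (h : ¬ [e.1.1, e.1.2] <:+: p) : pathLength (Function.update w e y) p = pathLength w p := by
  refine pathLength_congr p fun u v huv => edgeWeight_update_of_ne w y fun h0 => h ?_
  rw [← h0]; exact huv

theorem pathLength_update_of_infix (w : Edge n → ℝ) {e : Edge n} (y : ℝ) :
    ∀ p : List (Fin n), p.Nodup → [e.1.1, e.1.2] <:+: p →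
      pathLength (Function.update w e y) p = y + pathLength (Function.update w e 0) p
  | [], _, h => by simp at h
  | [_], _, h => by have := h.length_le; simp at this
  | u :: v :: p, hp, h => by
    rw [pathLength_cons_cons, pathLength_cons_cons]
    have hu : u ∉ v :: p := (List.nodup_cons.1 hp).1
    by_cases huv : (u, v) = e.1
    · have h1 : ∀ z, edgeWeight (Function.update w e z) u v = z := fun z => by
        have := edgeWeight_update_self w e z
        rwa [← huv] at this
      have h2 : ¬ [e.1.1, e.1.2] <:+: v :: p := fun h3 => hu (by
        rw [← huv] at h3
        exact h3.subset (by simp))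
      rw [h1, h1, pathLength_update_of_not_infix w _ h2, pathLength_update_of_not_infix w _ h2]
      ring
    · rw [edgeWeight_update_of_ne w _ huv, edgeWeight_update_of_ne w _ huv]
      have h2 : [e.1.1, e.1.2] <:+: v :: p := by
        rcases List.infix_cons_iff.1 h with h3 | h3
        · simp only [List.cons_prefix_cons, List.nil_prefix, and_true] at h3
          exact absurd (Prod.ext h3.1.symm h3.2.symm) huv
        · exact h3
      rw [pathLength_update_of_infix w y (v :: p) (List.nodup_cons.1 hp).2 h2]
      ring

/-- A path with distinct vertices that starts at `b` never enters `b`. Together with its mirror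
image below, this makes `D(b,c)` independent of the outer edges of `a → b ⇝ c → d`. -/
theorem distance_update_of_snd_eq (w : Edge n → ℝ) (e : Edge n) (y : ℝ) {b : Fin n} (c : Fin n)
    (h : e.1.2 = b) : distance (Function.update w e y) b c = distance w b c := by
  unfold distance
  congr 1; ext x
  refine exists_congr fun p => and_congr_right fun hp => ?_
  rw [pathLength_update_of_not_infix w y]
  rw [h]; exact hp.not_infix_head

theorem distance_update_of_fst_eq (w : Edge n → ℝ) (e : Edge n) (y : ℝ) (b : Fin n) {c : Fin n}
    (h : e.1.1 = c) : distance (Function.update w e y) b c = distance w b c := by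
  unfold distance
  congr 1; ext x
  refine exists_congr fun p => and_congr_right fun hp => ?_
  rw [pathLength_update_of_not_infix w y]
  rw [h]; exact hp.not_infix_last

end Paths

/-! ### Distances from a set of vertices, and the absorption of a vertex by an edge of cost zero. -/

section SetDistance

open scoped ENNReal

variable {n : ℕ}

/-- The total cost of a path. -/
def pathCost (c : Fin n → Fin n → ℝ≥0∞) : List (Fin n) → ℝ≥0∞
  | [] => 0
  | [_] => 0
  | u :: v :: p => c u v + pathCost c (v :: p)

/-- The distance from `t` to `b` along paths inside `T`. -/
noncomputable def restrictedDist (c : Fin n → Fin n → ℝ≥0∞) (T : Finset (Fin n))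
    (t b : Fin n) : ℝ≥0∞ :=
  ⨅ p : List (Fin n), ⨅ _ : IsPath t b p ∧ ∀ v ∈ p, v ∈ T, pathCost c p

/-- The distance to `b` from the set `S`, along paths that leave `S` in their first step. -/
noncomputable def setDist (c : Fin n → Fin n → ℝ≥0∞) (S : Finset (Fin n)) (b : Fin n) : ℝ≥0∞ :=
  ⨅ e ∈ S ×ˢ Sᶜ, c e.1 e.2 + restrictedDist c Sᶜ e.2 b

theorem restrictedDist_le {c : Fin n → Fin n → ℝ≥0∞} {T : Finset (Fin n)} {t b : Fin n}
    {p : List (Fin n)} (hp : IsPath t b p) (hT : ∀ v ∈ p, v ∈ T) :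
    restrictedDist c T t b ≤ pathCost c p := iInf₂_le p ⟨hp, hT⟩

theorem setDist_le {c : Fin n → Fin n → ℝ≥0∞} {S : Finset (Fin n)} {b s t : Fin n}
    (hs : s ∈ S) (ht : t ∉ S) : setDist c S b ≤ c s t + restrictedDist c Sᶜ t b :=
  iInf₂_le (s, t) (by simp [hs, ht])

theorem pathCost_congr {c c' : Fin n → Fin n → ℝ≥0∞} {T : Finset (Fin n)}
    (h : ∀ u ∈ T, ∀ v ∈ T, c u v = c' u v) :
    ∀ p : List (Fin n), (∀ v ∈ p, v ∈ T) → pathCost c p = pathCost c' p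
  | [], _ => rfl
  | [_], _ => rfl
  | u :: v :: p, hp => by
    simp only [pathCost]
    rw [h u (hp u (by simp)) v (hp v (by simp)),
      pathCost_congr h (v :: p) fun x hx => hp x (List.mem_cons_of_mem _ hx)]

theorem restrictedDist_congr {c c' : Fin n → Fin n → ℝ≥0∞} {T : Finset (Fin n)}
    (h : ∀ u ∈ T, ∀ v ∈ T, c u v = c' u v) (t b : Fin n) :
    restrictedDist c T t b = restrictedDist c' T t b := by
  unfold restrictedDist
  refine iInf_congr fun p => iInf_congr fun hp => pathCost_congr h p hp.2

theorem restrictedDist_self {c : Fin n → Fin n → ℝ≥0∞} {T : Finset (Fin n)} {b : Fin n}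
    (hb : b ∈ T) : restrictedDist c T b b = 0 := by
  refine le_antisymm ((restrictedDist_le (p := [b]) (by simp [IsPath]) (by simpa)).trans ?_)
    zero_le
  simp [pathCost]

theorem restrictedDist_anti {c : Fin n → Fin n → ℝ≥0∞} {T T' : Finset (Fin n)} (h : T ⊆ T')
    (t b : Fin n) : restrictedDist c T' t b ≤ restrictedDist c T t b :=
  le_iInf₂ fun _ hp => restrictedDist_le hp.1 fun v hv => h (hp.2 v hv)

theorem pathCost_le_cons (c : Fin n → Fin n → ℝ≥0∞) (u : Fin n) :
    ∀ p : List (Fin n), pathCost c p ≤ pathCost c (u :: p)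
  | [] => zero_le
  | _ :: _ => le_add_self

theorem pathCost_suffix_le (c : Fin n → Fin n → ℝ≥0∞) (p : List (Fin n)) :
    ∀ s : List (Fin n), pathCost c p ≤ pathCost c (s ++ p)
  | [] => le_rfl
  | u :: s => (pathCost_suffix_le c p s).trans (pathCost_le_cons c u (s ++ p))

/-- The first-step decomposition of a distance. -/
theorem restrictedDist_eq_iInf {c : Fin n → Fin n → ℝ≥0∞} {T : Finset (Fin n)} {t b : Fin n}
    (ht : t ∈ T) (htb : t ≠ b) :
    restrictedDist c T t b = ⨅ v ∈ T.erase t, c t v + restrictedDist c (T.erase t) v b := by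
  apply le_antisymm
  · refine le_iInf₂ fun v hv => ?_
    unfold restrictedDist
    rw [ENNReal.add_iInf]
    refine le_iInf fun p => ?_
    by_cases hp : IsPath v b p ∧ ∀ u ∈ p, u ∈ T.erase t
    · rw [iInf_pos hp]
      have hp1 := hp.1.1
      cases p with
      | nil => simp at hp1
      | cons u p =>
        obtain rfl : u = v := by simpa using hp1
        refine iInf₂_le (t :: u :: p) ⟨⟨rfl, ?_, List.nodup_cons.2 ⟨fun h => ?_, hp.1.2.2⟩⟩, ?_⟩
        · simpa using hp.1.2.1
        · exact Finset.notMem_erase t T (hp.2 t h)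
        · intro x hx
          rcases List.mem_cons.1 hx with rfl | hx
          · exact ht
          · exact Finset.mem_of_mem_erase (hp.2 x hx)
    · rw [iInf_neg hp]; simp
  · refine le_iInf₂ fun p hp => ?_
    obtain ⟨⟨h1, h2, h3⟩, hT⟩ := hp
    match p, h1, h2, h3, hT with
    | [], h1, _, _, _ => simp at h1
    | [u], h1, h2, _, _ => simp at h1 h2; exact absurd (h1.symm.trans h2) htb
    | u :: v :: p, h1, h2, h3, hT =>
      obtain rfl : u = t := by simpa using h1
      have hu := (List.nodup_cons.1 h3).1
      have hq : ∀ x ∈ v :: p, x ∈ T.erase u := fun x hx =>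
        Finset.mem_erase.2 ⟨fun h => hu (h ▸ hx), hT x (List.mem_cons_of_mem _ hx)⟩
      refine (iInf₂_le v (hq v (by simp))).trans ?_
      simp only [pathCost]
      gcongr
      exact restrictedDist_le ⟨rfl, by simpa using h2, (List.nodup_cons.1 h3).2⟩ hq

/-- A path either avoids `t₀`, or its final piece starting at `t₀` costs no more than the whole. -/
theorem min_restrictedDist_erase_le (c : Fin n → Fin n → ℝ≥0∞) (T : Finset (Fin n))
    (t t₀ b : Fin n) :
    min (restrictedDist c (T.erase t₀) t b) (restrictedDist c T t₀ b) ≤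
      restrictedDist c T t b := by
  refine le_iInf₂ fun p hp => ?_
  obtain ⟨hp, hT⟩ := hp
  by_cases h : t₀ ∈ p
  · obtain ⟨q, r, rfl⟩ := List.append_of_mem h
    refine (min_le_right _ _).trans ((restrictedDist_le ⟨rfl, ?_, ?_⟩ fun v hv => hT v ?_).trans
      (pathCost_suffix_le c (t₀ :: r) q))
    · simpa using hp.2.1
    · exact hp.2.2.sublist (List.sublist_append_right _ _)
    · exact List.mem_append_right _ hv
  · refine (min_le_left _ _).trans (restrictedDist_le hp fun v hv => ?_)
    exact Finset.mem_erase.2 ⟨fun h' => h (h' ▸ hv), hT v hv⟩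

/-- Setting the cost of an edge leaving `S` to zero moves its endpoint into `S`. -/
theorem setDist_of_edge_eq_zero {c c' : Fin n → Fin n → ℝ≥0∞} {S : Finset (Fin n)}
    {b s₀ t₀ : Fin n} (hs₀ : s₀ ∈ S) (ht₀ : t₀ ∉ S) (hb : b ∉ S) (h0 : c' s₀ t₀ = 0)
    (hc : ∀ u v, (u, v) ≠ (s₀, t₀) → c' u v = c u v) :
    setDist c' S b = if t₀ = b then 0 else setDist c (insert t₀ S) b := by
  -- A path inside `Sᶜ` cannot use the modified edge, whose tail lies in `S`.
  have hR : ∀ t, restrictedDist c' Sᶜ t b = restrictedDist c Sᶜ t b := fun t =>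
    restrictedDist_congr (fun u hu v _ => hc u v fun h => by
      simp only [Prod.mk.injEq] at h
      exact Finset.mem_compl.1 hu (h.1 ▸ hs₀)) t b
  have hle : setDist c' S b ≤ restrictedDist c Sᶜ t₀ b := by
    refine (setDist_le hs₀ ht₀).trans ?_
    rw [h0, zero_add, hR]
  split_ifs with htb
  · subst htb
    refine le_antisymm (hle.trans ?_) zero_le
    rw [restrictedDist_self (Finset.mem_compl.2 hb)]
  · have hcompl : (insert t₀ S)ᶜ = Sᶜ.erase t₀ := by simp [Finset.compl_insert]
    have hR₀ : restrictedDist c Sᶜ t₀ b =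
        ⨅ v ∈ Sᶜ.erase t₀, c t₀ v + restrictedDist c (Sᶜ.erase t₀) v b :=
      restrictedDist_eq_iInf (Finset.mem_compl.2 ht₀) htb
    have hge : setDist c (insert t₀ S) b ≤ restrictedDist c Sᶜ t₀ b := by
      rw [hR₀]
      refine le_iInf₂ fun v hv => ?_
      have := setDist_le (c := c) (b := b) (Finset.mem_insert_self t₀ S)
        (Finset.mem_compl.1 (hcompl ▸ hv))
      rwa [hcompl] at this
    apply le_antisymm
    · refine le_iInf₂ fun e he => ?_
      obtain ⟨s, t⟩ := e
      rw [hcompl]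
      simp only [Finset.mem_product, Finset.mem_insert, Finset.mem_compl, not_or] at he
      obtain ⟨hs | hs, ht, ht'⟩ := he
      · subst hs
        refine hle.trans (hR₀.trans_le (iInf₂_le t ?_))
        simp [ht, ht']
      · refine (setDist_le hs ht').trans ?_
        rw [hc s t (by simp [ht]), hR]
        gcongr
        exact restrictedDist_anti (Finset.erase_subset _ _) _ _
    · refine le_iInf₂ fun e he => ?_
      obtain ⟨s, t⟩ := e
      simp only [Finset.mem_product, Finset.mem_compl] at he
      obtain ⟨hs, ht⟩ := he
      simp only [hR]
      by_cases htt : t = t₀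
      · subst htt
        exact hge.trans le_add_self
      · rw [hc s t (by simp [htt])]
        refine le_trans ?_ (add_le_add_right (min_restrictedDist_erase_le c Sᶜ t t₀ b) (c s t))
        rw [← min_add_add_left]
        refine le_min ?_ (hge.trans le_add_self)
        have := setDist_le (c := c) (b := b) (s := s) (t := t) (S := insert t₀ S)
          (by simp [hs]) (by simp [htt, ht])
        rwa [hcompl] at this

/-- The edge costs given by real weights. -/
noncomputable def weightCost (x : Edge n → ℝ) (u v : Fin n) : ℝ≥0∞ :=
  ENNReal.ofReal (edgeWeight x u v)

theorem pathCost_weightCost {x : Edge n → ℝ} (hx : ∀ e, 0 ≤ x e) :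
    ∀ p : List (Fin n), pathCost (weightCost x) p = ENNReal.ofReal (pathLength x p)
  | [] => by simp [pathCost, pathLength]
  | [_] => by simp [pathCost, pathLength]
  | u :: v :: p => by
    rw [pathLength_cons_cons, ENNReal.ofReal_add (edgeWeight_nonneg hx u v)
      (pathLength_nonneg hx _), ← pathCost_weightCost hx (v :: p)]
    rfl

theorem setDist_singleton {x : Edge n → ℝ} (hx : ∀ e, 0 ≤ x e) {a b : Fin n} (hab : a ≠ b) :
    setDist (weightCost x) {a} b = ENNReal.ofReal (distance x a b) := by
  have h1 : setDist (weightCost x) {a} b = restrictedDist (weightCost x) Finset.univ a b := by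
    have hc : ({a} : Finset (Fin n))ᶜ = Finset.univ.erase a := by ext; simp
    rw [restrictedDist_eq_iInf (Finset.mem_univ a) hab]
    unfold setDist
    rw [hc]
    apply le_antisymm
    · exact le_iInf₂ fun v hv => iInf₂_le (a, v) (by simp at hv; simp [hv])
    · refine le_iInf₂ fun e he => ?_
      obtain ⟨s, t⟩ := e
      simp only [Finset.mem_product, Finset.mem_singleton] at he
      obtain ⟨rfl, ht⟩ := he
      exact iInf₂_le t ht
  rw [h1]
  apply le_antisymm
  · obtain ⟨p, hp, h⟩ := exists_isPath_pathLength_eq x a b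
    rw [← h, ← pathCost_weightCost hx]
    exact restrictedDist_le hp fun v _ => Finset.mem_univ v
  · refine le_iInf₂ fun p hp => ?_
    rw [pathCost_weightCost hx]
    exact ENNReal.ofReal_le_ofReal (distance_le_pathLength x hp.1)

theorem measurable_weightCost (u v : Fin n) :
    Measurable fun x : Edge n → ℝ => weightCost x u v := by
  unfold weightCost edgeWeight
  split_ifs
  · exact (measurable_pi_apply _).ennreal_ofReal
  · simp

theorem measurable_pathCost :
    ∀ p : List (Fin n), Measurable fun x : Edge n → ℝ => pathCost (weightCost x) p
  | [] => measurable_const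
  | [_] => measurable_const
  | u :: v :: p => (measurable_weightCost u v).add (measurable_pathCost (v :: p))

theorem measurable_restrictedDist (T : Finset (Fin n)) (t b : Fin n) :
    Measurable fun x : Edge n → ℝ => restrictedDist (weightCost x) T t b :=
  Measurable.iInf fun p => Measurable.iInf fun _ => measurable_pathCost p

theorem measurable_setDist (S : Finset (Fin n)) (b : Fin n) :
    Measurable fun x : Edge n → ℝ => setDist (weightCost x) S b :=
  Measurable.iInf fun _ => Measurable.iInf fun _ =>
    (measurable_weightCost _ _).add (measurable_restrictedDist _ _ _)

end SetDistance

/-! ### Integration by parts for the exponential law. -/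

section Exponential

open scoped ENNReal

/-- Resampling one coordinate does not change a product law. This reduces later arguments to
integrals over a single edge weight. -/
theorem lintegral_pi_eq_lintegral_update {ι : Type*} [Fintype ι] [DecidableEq ι] {X : Type*}
    [MeasurableSpace X] (ν : Measure X) [IsProbabilityMeasure ν] (i : ι)
    {f : (ι → X) → ℝ≥0∞} (hf : Measurable f) :
    ∫⁻ x, f x ∂(Measure.pi fun _ => ν) =
      ∫⁻ x, ∫⁻ y, f (Function.update x i y) ∂ν ∂(Measure.pi fun _ => ν) := by
  have h : (fun x => ∫⁻ y, f (Function.update x i y) ∂ν) =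
      lmarginal (fun _ => ν) {i} f := (lmarginal_singleton (μ := fun _ : ι => ν) f i).symm
  rw [h]
  refine lintegral_eq_of_lmarginal_eq (μ := fun _ : ι => ν) {i} hf (hf.lmarginal fun _ => ν) ?_
  rw [lmarginal_singleton (lmarginal (fun _ => ν) {i} f) i]
  ext x
  simp [lmarginal_update_of_mem (fun _ => ν) (Finset.mem_singleton_self i)]

instance : IsProbabilityMeasure (expMeasure 1) := isProbabilityMeasure_expMeasure one_pos

theorem lintegral_expMeasure (f : ℝ → ℝ≥0∞) (hf : Measurable f) :
    ∫⁻ x, f x ∂(expMeasure 1) = ∫⁻ x in Set.Ioi 0, ENNReal.ofReal (Real.exp (-x)) * f x := by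
  have h : expMeasure 1 = volume.withDensity (exponentialPDF 1) := rfl
  have hm : Measurable (exponentialPDF 1) := (measurable_exponentialPDFReal 1).ennreal_ofReal
  rw [h, lintegral_withDensity_eq_lintegral_mul _ hm hf,
    setLIntegral_congr Ioi_ae_eq_Ici, ← lintegral_indicator measurableSet_Ici]
  refine lintegral_congr fun x => ?_
  by_cases hx : 0 ≤ x
  · rw [Set.indicator_of_mem (Set.mem_Ici.2 hx), Pi.mul_apply, exponentialPDF_of_nonneg hx]
    simp
  · rw [Set.indicator_of_notMem (by simpa using hx), Pi.mul_apply,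
      exponentialPDF_of_neg (not_le.1 hx), zero_mul]

theorem expMeasure_Ioi {t : ℝ} (ht : 0 ≤ t) :
    expMeasure 1 (Set.Ioi t) = ENNReal.ofReal (Real.exp (-t)) := by
  have h := cdf_expMeasure_eq one_pos t
  rw [if_pos ht, one_mul] at h
  rw [← Set.compl_Iic, prob_compl_eq_one_sub measurableSet_Iic, ← ofReal_cdf, h,
    ← ENNReal.ofReal_one, ← ENNReal.ofReal_sub]
  · simp
  · simp [ht]

theorem expMeasure_Iic_zero : expMeasure 1 (Set.Iic 0) = 0 := by
  rw [← ofReal_cdf, cdf_expMeasure_eq one_pos]; simp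

theorem expMeasure_ae_pos : ∀ᵐ x ∂(expMeasure 1), 0 < x := by
  rw [ae_iff]; simpa [Set.Iic] using expMeasure_Iic_zero

instance : NullSingletonClass (expMeasure 1) := by
  have h : expMeasure 1 = volume.withDensity (exponentialPDF 1) := rfl
  rw [h]; infer_instance

/-- After swapping the integrals, `g t` is weighted by the tail `P(x > t) = exp (-t)`, which is also
the density of the exponential law of rate one. -/
theorem lintegral_lintegral_Ioo_expMeasure {g : ℝ → ℝ≥0∞} (hg : Measurable g) :
    ∫⁻ x, (∫⁻ t in Set.Ioo 0 x, g t) ∂(expMeasure 1) = ∫⁻ x, g x ∂(expMeasure 1) := by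
  have h1 : ∀ x, ∫⁻ t in Set.Ioo 0 x, g t =
      ∫⁻ t in Set.Ioi 0, (Set.Ioi t).indicator (fun _ => g t) x := by
    intro x
    have : ∀ t, (Set.Ioi t).indicator (fun _ => g t) x = (Set.Iio x).indicator g t := fun t => rfl
    simp_rw [this]
    rw [setLIntegral_indicator measurableSet_Iio, Set.inter_comm, Set.Ioi_inter_Iio]
  simp_rw [h1]
  rw [lintegral_lintegral_swap]
  · rw [lintegral_expMeasure g hg]
    refine setLIntegral_congr_fun measurableSet_Ioi fun t ht => ?_
    rw [lintegral_indicator_const measurableSet_Ioi, expMeasure_Ioi (le_of_lt ht), mul_comm]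
  · have : Function.uncurry (fun x t : ℝ => (Set.Ioi t).indicator (fun _ => g t) x) =
        {p : ℝ × ℝ | p.2 < p.1}.indicator fun p => g p.2 := by
      ext p; rfl
    rw [this]
    exact ((hg.comp measurable_snd).indicator
      (measurableSet_lt measurable_snd measurable_fst)).aemeasurable

/-- The fundamental theorem of calculus for `t ↦ min A (t + B) ^ j`, whose derivative vanishes once
`t + B` exceeds `A`. Infinite `A` and `B` are allowed, since an infimum over no paths is infinite.
-/
theorem min_pow_eq_lintegral (A B : ℝ≥0∞) {x : ℝ} (hx : 0 ≤ x) {j : ℕ} (hj : j ≠ 0) :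
    min A (ENNReal.ofReal x + B) ^ j = min A B ^ j +
      ∫⁻ t in Set.Ioo 0 x, {t : ℝ | ENNReal.ofReal t + B < A}.indicator
        (fun t => j * min A (ENNReal.ofReal t + B) ^ (j - 1)) t := by
  have hm : MeasurableSet {t : ℝ | ENNReal.ofReal t + B < A} :=
    measurableSet_lt (by fun_prop) measurable_const
  rcases le_or_gt A B with hAB | hAB
  · have : {t : ℝ | ENNReal.ofReal t + B < A} = ∅ := by
      ext t; simpa using hAB.trans le_add_self
    rw [this, min_eq_left hAB, min_eq_left (hAB.trans le_add_self)]
    simp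
  · obtain ⟨b, hb, rfl⟩ : ∃ b : ℝ, 0 ≤ b ∧ B = ENNReal.ofReal b :=
      ⟨B.toReal, ENNReal.toReal_nonneg, (ENNReal.ofReal_toReal hAB.ne_top).symm⟩
    -- Here `c` is the end of the interval on which the minimum still grows: `x` itself, or the
    -- point where `t + b` reaches `A`.
    obtain ⟨c, hc0, hcA, hset⟩ : ∃ c : ℝ, 0 ≤ c ∧
        min A (ENNReal.ofReal x + ENNReal.ofReal b) = ENNReal.ofReal c + ENNReal.ofReal b ∧
        {t : ℝ | ENNReal.ofReal t + ENNReal.ofReal b < A} ∩ Set.Ioo 0 x = Set.Ioo 0 c := by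
      rcases le_or_gt (ENNReal.ofReal x + ENNReal.ofReal b) A with h | h
      · refine ⟨x, hx, min_eq_right h, ?_⟩
        rw [Set.inter_eq_right]
        intro t ht
        refine lt_of_lt_of_le ?_ h
        exact ENNReal.add_lt_add_right ENNReal.ofReal_ne_top
          ((ENNReal.ofReal_lt_ofReal_iff (ht.1.trans ht.2)).2 ht.2)
      · obtain ⟨a, ha, rfl⟩ : ∃ a : ℝ, 0 ≤ a ∧ A = ENNReal.ofReal a :=
          ⟨A.toReal, ENNReal.toReal_nonneg, (ENNReal.ofReal_toReal h.ne_top).symm⟩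
        have hAB' : b < a := (ENNReal.ofReal_lt_ofReal_iff_of_nonneg hb).1 hAB
        have e1 : ∀ t : ℝ, 0 ≤ t → (ENNReal.ofReal t + ENNReal.ofReal b < ENNReal.ofReal a ↔
            t < a - b) := by
          intro t ht
          rw [← ENNReal.ofReal_add ht hb, ENNReal.ofReal_lt_ofReal_iff (hb.trans_lt hAB'),
            lt_sub_iff_add_lt]
        refine ⟨a - b, by linarith, ?_, ?_⟩
        · rw [min_eq_left h.le, ← ENNReal.ofReal_add (by linarith) hb, sub_add_cancel]
        · have hx' : a - b ≤ x := by
            by_contra! hx'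
            exact absurd ((e1 x hx).2 hx') h.not_gt
          ext t
          simp only [Set.mem_inter_iff, Set.mem_ofPred_eq, Set.mem_Ioo]
          constructor
          · rintro ⟨h1, h2, h3⟩; exact ⟨h2, (e1 t h2.le).1 h1⟩
          · rintro ⟨h1, h2⟩; exact ⟨(e1 t h1.le).2 h2, h1, h2.trans_le hx'⟩
    rw [setLIntegral_indicator hm, hset, hcA, min_eq_right hAB.le]
    have h2 : ∫⁻ t in Set.Ioo 0 c, (j : ℝ≥0∞) * min A (ENNReal.ofReal t + ENNReal.ofReal b) ^ (j - 1) =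
        ∫⁻ t in Set.Ioo 0 c, ENNReal.ofReal (j * (t + b) ^ (j - 1)) := by
      refine setLIntegral_congr_fun measurableSet_Ioo fun t ht => ?_
      have : t ∈ {t : ℝ | ENNReal.ofReal t + ENNReal.ofReal b < A} ∩ Set.Ioo 0 x := hset ▸ ht
      have hlt : ENNReal.ofReal t + ENNReal.ofReal b < A := this.1
      rw [min_eq_right hlt.le, ENNReal.ofReal_mul (by positivity), ENNReal.ofReal_natCast,
        ENNReal.ofReal_pow (by have := ht.1; positivity), ENNReal.ofReal_add ht.1.le hb]
    have hcont : Continuous fun t : ℝ => (j : ℝ) * (t + b) ^ (j - 1) := by fun_prop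
    have h3 : ∫ t in (0 : ℝ)..c, (j : ℝ) * (t + b) ^ (j - 1) = (c + b) ^ j - (0 + b) ^ j :=
      intervalIntegral.integral_eq_sub_of_hasDerivAt (f := fun t : ℝ => (t + b) ^ j)
        (fun t _ => by
          have := ((hasDerivAt_id' t).add_const b).fun_pow j
          rwa [mul_one] at this)
        (hcont.intervalIntegrable _ _)
    rw [h2, ← ofReal_integral_eq_lintegral_ofReal, ← integral_Ioc_eq_integral_Ioo,
      ← intervalIntegral.integral_of_le hc0, h3,
      ← ENNReal.ofReal_add hc0 hb, ← ENNReal.ofReal_pow (by positivity),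
      ← ENNReal.ofReal_pow (by positivity), ← ENNReal.ofReal_add (by positivity)]
    · congr 1; ring
    · have : (0 + b) ^ j ≤ (c + b) ^ j := by gcongr
      linarith
    · exact (hcont.integrableOn_Icc).mono_set Set.Ioo_subset_Icc_self
    · refine (ae_restrict_iff' measurableSet_Ioo).2 (Eventually.of_forall fun t ht => ?_)
      have := ht.1
      positivity

/-- This is `E f(X) = f(0) + E f'(X)` for `f x = min A (x + B) ^ j`. -/
theorem lintegral_min_pow_expMeasure (A B : ℝ≥0∞) {j : ℕ} (hj : j ≠ 0) :
    ∫⁻ x, min A (ENNReal.ofReal x + B) ^ j ∂(expMeasure 1) = min A B ^ j +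
      j * ∫⁻ x, {x : ℝ | ENNReal.ofReal x + B < A}.indicator
        (fun x => min A (ENNReal.ofReal x + B) ^ (j - 1)) x ∂(expMeasure 1) := by
  have hm : MeasurableSet {t : ℝ | ENNReal.ofReal t + B < A} :=
    measurableSet_lt (by fun_prop) measurable_const
  have hg : Measurable ({x : ℝ | ENNReal.ofReal x + B < A}.indicator
        (fun x => min A (ENNReal.ofReal x + B) ^ (j - 1))) :=
    Measurable.indicator (by fun_prop) hm
  rw [lintegral_congr_ae (g := fun x => min A B ^ j +
      ∫⁻ t in Set.Ioo 0 x, {t : ℝ | ENNReal.ofReal t + B < A}.indicator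
        (fun t => j * min A (ENNReal.ofReal t + B) ^ (j - 1)) t)
      (expMeasure_ae_pos.mono fun x hx => min_pow_eq_lintegral A B hx.le hj),
    lintegral_add_left measurable_const, lintegral_const, measure_univ, mul_one,
    lintegral_lintegral_Ioo_expMeasure (Measurable.indicator (by fun_prop) hm),
    ← lintegral_const_mul _ hg]
  congr 1
  refine lintegral_congr fun x => ?_
  by_cases h : x ∈ {x : ℝ | ENNReal.ofReal x + B < A}
  · simp only [Set.indicator_of_mem h]
  · simp only [Set.indicator_of_notMem h, mul_zero]

/-- An atomless coordinate almost surely avoids a value given by the other coordinates. -/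
theorem pi_null_of_fiber {ι : Type*} [Fintype ι] [DecidableEq ι] {X : Type*}
    [MeasurableSpace X] (ν : Measure X) [IsProbabilityMeasure ν] (i : ι)
    {s : Set (ι → X)} (hs : MeasurableSet s)
    (h : ∀ x, ν {y | Function.update x i y ∈ s} = 0) :
    (Measure.pi fun _ : ι => ν) s = 0 := by
  rw [← lintegral_indicator_one hs, lintegral_pi_eq_lintegral_update ν i
    (measurable_one.indicator hs)]
  refine (lintegral_congr fun x => ?_).trans lintegral_zero
  have : ∀ y, s.indicator (1 : (ι → X) → ℝ≥0∞) (Function.update x i y) =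
      {y | Function.update x i y ∈ s}.indicator 1 y := fun y => rfl
  simp_rw [this]
  rw [lintegral_indicator_one (s := {y | Function.update x i y ∈ s}) (measurable_update x hs), h]

end Exponential

/-! ### The recursion for moments of distances in the exponential model. -/

section Recursion

open scoped ENNReal

variable {n : ℕ}

/-- The law of independent exponential edge weights of rate one. -/
noncomputable def expWeights (n : ℕ) : Measure (Edge n → ℝ) := Measure.pi fun _ => expMeasure 1

instance : IsProbabilityMeasure (expWeights n) := by unfold expWeights; infer_instance

theorem weightCost_update_of_ne (x : Edge n → ℝ) {E : Edge n} {u v : Fin n} (y : ℝ)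
    (h : (u, v) ≠ E.1) : weightCost (Function.update x E y) u v = weightCost x u v := by
  unfold weightCost; rw [edgeWeight_update_of_ne x y h]

theorem weightCost_update_self (x : Edge n → ℝ) (E : Edge n) (y : ℝ) :
    weightCost (Function.update x E y) E.1.1 E.1.2 = ENNReal.ofReal y := by
  unfold weightCost; rw [edgeWeight_update_self]

/-- The distance from `S` to `b` along paths whose first edge differs from `e`. -/
noncomputable def setDistAvoid (c : Fin n → Fin n → ℝ≥0∞) (S : Finset (Fin n)) (b : Fin n)
    (e : Fin n × Fin n) : ℝ≥0∞ :=
  ⨅ e' ∈ (S ×ˢ Sᶜ).erase e, c e'.1 e'.2 + restrictedDist c Sᶜ e'.2 b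

theorem setDist_eq_min (c : Fin n → Fin n → ℝ≥0∞) {S : Finset (Fin n)} (b : Fin n)
    {e : Fin n × Fin n} (he : e ∈ S ×ˢ Sᶜ) :
    setDist c S b = min (setDistAvoid c S b e) (c e.1 e.2 + restrictedDist c Sᶜ e.2 b) := by
  unfold setDist setDistAvoid
  conv_lhs => rw [← Finset.insert_erase he]
  rw [Finset.iInf_insert, min_comm]

theorem measurable_setDistAvoid (S : Finset (Fin n)) (b : Fin n) (e : Fin n × Fin n) :
    Measurable fun x : Edge n → ℝ => setDistAvoid (weightCost x) S b e :=
  Measurable.iInf fun _ => Measurable.iInf fun _ =>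
    (measurable_weightCost _ _).add (measurable_restrictedDist _ _ _)

theorem restrictedDist_update {S : Finset (Fin n)} (b t : Fin n) {E : Edge n} (hE : E.1.1 ∈ S)
    (x : Edge n → ℝ) (y : ℝ) :
    restrictedDist (weightCost (Function.update x E y)) Sᶜ t b =
      restrictedDist (weightCost x) Sᶜ t b :=
  restrictedDist_congr (fun u hu v _ => weightCost_update_of_ne x y fun h =>
    Finset.mem_compl.1 hu (by rw [← h] at hE; exact hE)) t b

theorem setDistAvoid_update {S : Finset (Fin n)} (b : Fin n) {E : Edge n} (hE : E.1.1 ∈ S)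
    (x : Edge n → ℝ) (y : ℝ) :
    setDistAvoid (weightCost (Function.update x E y)) S b E.1 =
      setDistAvoid (weightCost x) S b E.1 := by
  unfold setDistAvoid
  refine iInf_congr fun e => iInf_congr fun he => ?_
  rw [restrictedDist_update b _ hE, weightCost_update_of_ne x y (Finset.ne_of_mem_erase he)]

/-- The event that the first edge of the shortest path from `S` to `b` is `E`. -/
def firstEdgeSet (S : Finset (Fin n)) (b : Fin n) (E : Edge n) : Set (Edge n → ℝ) :=
  {x | weightCost x E.1.1 E.1.2 + restrictedDist (weightCost x) Sᶜ E.1.2 b <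
    setDistAvoid (weightCost x) S b E.1}

theorem measurableSet_firstEdgeSet (S : Finset (Fin n)) (b : Fin n) (E : Edge n) :
    MeasurableSet (firstEdgeSet S b E) :=
  measurableSet_lt ((measurable_weightCost _ _).add (measurable_restrictedDist _ _ _))
    (measurable_setDistAvoid _ _ _)

/-- With all other weights fixed, the distance is `min A (y + B)` in the weight `y` of `E`: `A` is
the best length with another first edge, and `B` is the remaining distance after `E`. Neither
depends on `y`. -/
theorem lintegral_setDist_pow_edge {S : Finset (Fin n)} {b : Fin n} {E : Edge n}
    (hE : E.1 ∈ S ×ˢ Sᶜ) {j : ℕ} (hj : j ≠ 0) :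
    ∫⁻ x, setDist (weightCost x) S b ^ j ∂(expWeights n) =
      ∫⁻ x, setDist (weightCost (Function.update x E 0)) S b ^ j ∂(expWeights n) +
      j * ∫⁻ x, (firstEdgeSet S b E).indicator
        (fun x => setDist (weightCost x) S b ^ (j - 1)) x ∂(expWeights n) := by
  have hES : E.1.1 ∈ S := (Finset.mem_product.1 hE).1
  set A : (Edge n → ℝ) → ℝ≥0∞ := fun x => setDistAvoid (weightCost x) S b E.1 with hA
  set B : (Edge n → ℝ) → ℝ≥0∞ := fun x => restrictedDist (weightCost x) Sᶜ E.1.2 b with hB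
  have hupd : ∀ (x : Edge n → ℝ) (y : ℝ), setDist (weightCost (Function.update x E y)) S b =
      min (A x) (ENNReal.ofReal y + B x) := by
    intro x y
    rw [setDist_eq_min _ b hE, setDistAvoid_update b hES, restrictedDist_update b _ hES,
      weightCost_update_self]
  have hmem : ∀ (x : Edge n → ℝ) (y : ℝ), Function.update x E y ∈ firstEdgeSet S b E ↔
      ENNReal.ofReal y + B x < A x := by
    intro x y
    rw [firstEdgeSet, Set.mem_ofPred_eq, setDistAvoid_update b hES,
      restrictedDist_update b _ hES, weightCost_update_self]
  have hD := measurable_setDist S b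
  have hI : Measurable fun x => (firstEdgeSet S b E).indicator
      (fun x => setDist (weightCost x) S b ^ (j - 1)) x :=
    (hD.pow_const _).indicator (measurableSet_firstEdgeSet S b E)
  have hAm : Measurable A := measurable_setDistAvoid _ _ _
  have hBm : Measurable B := measurable_restrictedDist _ _ _
  unfold expWeights
  rw [lintegral_pi_eq_lintegral_update (expMeasure 1) E (hD.pow_const j),
    lintegral_pi_eq_lintegral_update (expMeasure 1) E hI]
  have h1 : ∀ x : Edge n → ℝ,
      ∫⁻ y, setDist (weightCost (Function.update x E y)) S b ^ j ∂(expMeasure 1) =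
      setDist (weightCost (Function.update x E 0)) S b ^ j +
      j * ∫⁻ y, (firstEdgeSet S b E).indicator (fun x => setDist (weightCost x) S b ^ (j - 1))
        (Function.update x E y) ∂(expMeasure 1) := by
    intro x
    simp_rw [hupd]
    rw [lintegral_min_pow_expMeasure (A x) (B x) hj]
    congr 2
    · simp
    · refine lintegral_congr fun y => ?_
      by_cases h : ENNReal.ofReal y + B x < A x
      · rw [Set.indicator_of_mem (s := {y : ℝ | ENNReal.ofReal y + B x < A x}) h,
          Set.indicator_of_mem ((hmem x y).2 h), hupd]
      · rw [Set.indicator_of_notMem (s := {y : ℝ | ENNReal.ofReal y + B x < A x}) h,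
          Set.indicator_of_notMem fun h' => h ((hmem x y).1 h')]
  simp_rw [h1]
  rw [lintegral_add_left, lintegral_const_mul']
  · exact ENNReal.natCast_ne_top j
  · simp_rw [hupd]
    fun_prop

theorem ae_expWeights_pos : ∀ᵐ x ∂(expWeights n), ∀ E : Edge n, 0 < x E :=
  ae_all_iff.2 fun _ => Measure.tendsto_eval_ae_ae.eventually expMeasure_ae_pos

/-- A tie prescribes the weight of `E` in terms of the other weights. Ties at infinity need not be
null and are left out; the optimal edge has finite total cost, so they do no harm. -/
theorem ae_ne_setDistAvoid {S : Finset (Fin n)} {b : Fin n} {E : Edge n}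
    (hE : E.1 ∈ S ×ˢ Sᶜ) : ∀ᵐ x ∂(expWeights n),
      ¬ (weightCost x E.1.1 E.1.2 + restrictedDist (weightCost x) Sᶜ E.1.2 b =
        setDistAvoid (weightCost x) S b E.1 ∧ setDistAvoid (weightCost x) S b E.1 ≠ ∞) := by
  have hES : E.1.1 ∈ S := (Finset.mem_product.1 hE).1
  rw [ae_iff]
  simp only [not_not]
  refine pi_null_of_fiber (expMeasure 1) E ?_ fun x => ?_
  · exact (measurableSet_eq_fun ((measurable_weightCost _ _).add
      (measurable_restrictedDist _ _ _)) (measurable_setDistAvoid _ _ _)).inter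
      ((measurable_setDistAvoid _ _ _) (measurableSet_singleton ∞).compl)
  · simp only [Set.mem_ofPred_eq, setDistAvoid_update b hES, restrictedDist_update b _ hES,
      weightCost_update_self]
    set A := setDistAvoid (weightCost x) S b E.1
    set B := restrictedDist (weightCost x) Sᶜ E.1.2 b
    -- `ENNReal.ofReal` collapses nonpositive `y`, so these go into a null half-line; for positive
    -- `y` a tie forces `y = A - B`.
    refine measure_mono_null (t := Set.Iic 0 ∪ {(A - B).toReal}) ?_
      (measure_union_null expMeasure_Iic_zero (measure_singleton _))
    rintro y ⟨h1, h2⟩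
    rcases le_or_gt y 0 with hy | hy
    · exact Or.inl hy
    · right
      have hB : B ≠ ∞ := fun h => h2 (by rw [← h1, h]; simp)
      rw [Set.mem_singleton_iff, ← h1, ENNReal.add_sub_cancel_right hB, ENNReal.toReal_ofReal hy.le]

theorem setDist_ne_top {S : Finset (Fin n)} (hS : S.Nonempty) {b : Fin n} (hb : b ∉ S)
    (x : Edge n → ℝ) : setDist (weightCost x) S b ≠ ∞ := by
  obtain ⟨s, hs⟩ := hS
  refine ne_top_of_le_ne_top ?_ (setDist_le hs hb)
  rw [restrictedDist_self (Finset.mem_compl.2 hb), add_zero]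
  exact ENNReal.ofReal_ne_top

/-- Without ties the minimising first edge is unique, so the events `firstEdgeSet` partition the
space up to a null set. -/
theorem ae_sum_indicator_firstEdgeSet {S : Finset (Fin n)} (hS : S.Nonempty) {b : Fin n}
    (hb : b ∉ S) (f : (Edge n → ℝ) → ℝ≥0∞) : ∀ᵐ x ∂(expWeights n),
      ∑ E : Edge n with E.1 ∈ S ×ˢ Sᶜ, (firstEdgeSet S b E).indicator f x = f x := by
  have h : ∀ᵐ x ∂(expWeights n), ∀ E : Edge n, E.1 ∈ S ×ˢ Sᶜ →
      ¬ (weightCost x E.1.1 E.1.2 + restrictedDist (weightCost x) Sᶜ E.1.2 b =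
        setDistAvoid (weightCost x) S b E.1 ∧ setDistAvoid (weightCost x) S b E.1 ≠ ∞) :=
    ae_all_iff.2 fun E => by
      by_cases hE : E.1 ∈ S ×ˢ Sᶜ
      · exact (ae_ne_setDistAvoid hE).mono fun x hx _ => hx
      · exact Eventually.of_forall fun x hx => absurd hx hE
  filter_upwards [h] with x hx
  obtain ⟨s, hs⟩ := hS
  obtain ⟨e, he, hmin⟩ := Finset.exists_min_image (S ×ˢ Sᶜ)
    (fun e => weightCost x e.1 e.2 + restrictedDist (weightCost x) Sᶜ e.2 b)
    ⟨(s, b), by simp [hs, hb]⟩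
  have hne : e.1 ≠ e.2 := fun h => by
    have := Finset.mem_product.1 he
    rw [Finset.mem_compl, ← h] at this
    exact this.2 this.1
  set E : Edge n := ⟨e, hne⟩
  have hD : setDist (weightCost x) S b =
      weightCost x e.1 e.2 + restrictedDist (weightCost x) Sᶜ e.2 b :=
    le_antisymm (iInf₂_le e he) (le_iInf₂ hmin)
  have htop := setDist_ne_top ⟨s, hs⟩ hb x
  have hE : x ∈ firstEdgeSet S b E := by
    have hle : setDist (weightCost x) S b ≤ setDistAvoid (weightCost x) S b E.1 :=
      (setDist_eq_min (weightCost x) b he).trans_le (min_le_left _ _)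
    rw [hD] at hle
    refine lt_of_le_of_ne hle fun h => hx E he ⟨h, ?_⟩
    rw [← h, ← hD]; exact htop
  rw [Finset.sum_eq_single E]
  · exact Set.indicator_of_mem hE f
  · intro E' hE' hne'
    refine Set.indicator_of_notMem (fun h' => ?_) f
    have h1 : setDistAvoid (weightCost x) S b E'.1 ≤
        weightCost x e.1 e.2 + restrictedDist (weightCost x) Sᶜ e.2 b :=
      iInf₂_le e (Finset.mem_erase.2 ⟨fun h => hne' (Subtype.ext h.symm), he⟩)
    exact absurd (h1.trans (hmin E'.1 (by simpa using hE'))) (not_le.2 h')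
  · intro h; exact absurd (by simpa using he) h

theorem card_edges (S : Finset (Fin n)) :
    (Finset.univ.filter fun E : Edge n => E.1 ∈ S ×ˢ Sᶜ).card = S.card * Sᶜ.card := by
  rw [← Finset.card_product]
  refine Finset.card_nbij (fun E => E.1) (fun E hE => by simpa using hE)
    (fun E _ E' _ h => Subtype.ext h) fun e he => ?_
  have he' : e.1 ∈ S ∧ e.2 ∉ S := by simpa using he
  exact ⟨⟨e, fun h => he'.2 (h ▸ he'.1)⟩, by simpa using he', rfl⟩

/-- The recursion for the moments of the distance from a set of vertices. -/
theorem setDist_moment_recursion {S : Finset (Fin n)} (hS : S.Nonempty) {b : Fin n}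
    (hb : b ∉ S) {j : ℕ} (hj : j ≠ 0) :
    ((S.card * Sᶜ.card : ℕ) : ℝ≥0∞) * ∫⁻ x, setDist (weightCost x) S b ^ j ∂(expWeights n) =
      ∑ E : Edge n with E.1 ∈ S ×ˢ Sᶜ, (if E.1.2 = b then 0 else
        ∫⁻ x, setDist (weightCost x) (insert E.1.2 S) b ^ j ∂(expWeights n)) +
      j * ∫⁻ x, setDist (weightCost x) S b ^ (j - 1) ∂(expWeights n) := by
  have hD := measurable_setDist S b
  -- The left side is the same moment repeated once per edge leaving `S`; each copy is expanded
  -- along its own edge.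
  rw [← card_edges, ← nsmul_eq_mul, ← Finset.sum_const]
  rw [Finset.sum_congr rfl fun E hE => lintegral_setDist_pow_edge (b := b)
    (by simpa using hE : E.1 ∈ S ×ˢ Sᶜ) hj, Finset.sum_add_distrib, ← Finset.mul_sum]
  congr 1
  · refine Finset.sum_congr rfl fun E hE => ?_
    have hE' : E.1.1 ∈ S ∧ E.1.2 ∉ S := by simpa using hE
    have h1 : ∀ x : Edge n → ℝ, setDist (weightCost (Function.update x E 0)) S b =
        if E.1.2 = b then 0 else setDist (weightCost x) (insert E.1.2 S) b := fun x =>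
      setDist_of_edge_eq_zero hE'.1 hE'.2 hb
        (by rw [weightCost_update_self, ENNReal.ofReal_zero])
        (fun u v h => weightCost_update_of_ne x 0 h)
    simp_rw [h1]
    split_ifs
    · simp [hj]
    · rfl
  · rw [← lintegral_finsetSum]
    · rw [lintegral_congr_ae (ae_sum_indicator_firstEdgeSet hS hb _)]
    · exact fun E _ => (hD.pow_const _).indicator (measurableSet_firstEdgeSet S b E)

/-- The `j`-th moment of the distance from a set of `n - r` vertices, multiplied by `r`. -/
noncomputable def momentSeq (n : ℕ) : ℕ → ℕ → ℝ
  | 0, r => r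
  | _ + 1, 0 => 0
  | j + 1, r + 1 => momentSeq n (j + 1) r +
      (j + 1) / (((n : ℝ) - (r + 1)) * (r + 1)) * momentSeq n j (r + 1)

theorem momentSeq_nonneg : ∀ j r : ℕ, r < n → 0 ≤ momentSeq n j r
  | 0, r, _ => by simp [momentSeq]
  | j + 1, 0, _ => by simp [momentSeq]
  | j + 1, r + 1, h => by
    have h1 := momentSeq_nonneg (j + 1) r (by omega)
    have h2 := momentSeq_nonneg j (r + 1) h
    have h3 : (0 : ℝ) < n - (r + 1) := by
      have : ((r + 1 : ℕ) : ℝ) < n := by exact_mod_cast h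
      push_cast at this; linarith
    rw [momentSeq]
    positivity

/-- Induction on `j`, and inside it on the number of vertices outside `S`: the recursion involves
only a lower moment for the same `S` and the same moment for larger sets. The factor `r` built into
`momentSeq` removes the weights from the recursion. -/
theorem lintegral_setDist_pow (j : ℕ) : ∀ (r : ℕ) (S : Finset (Fin n)) (b : Fin n),
    S.Nonempty → b ∉ S → Sᶜ.card = r →
    ∫⁻ x, setDist (weightCost x) S b ^ j ∂(expWeights n) =
      ENNReal.ofReal (momentSeq n j r / r) := by
  induction j with
  | zero =>
    intro r S b hS hb hr
    have : r ≠ 0 := by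
      rw [← hr]; exact (Finset.card_pos.2 ⟨b, Finset.mem_compl.2 hb⟩).ne'
    simp [momentSeq, this]
  | succ j ihj =>
    intro r
    induction r with
    | zero =>
      intro S b hS hb hr
      exact absurd hr (Finset.card_pos.2 ⟨b, Finset.mem_compl.2 hb⟩).ne'
    | succ r ihr =>
      intro S b hS hb hr
      have hrec := setDist_moment_recursion hS hb (Nat.succ_ne_zero j)
      have hScard : S.card + (r + 1) = n := by
        have := Finset.card_add_card_compl S
        rw [hr, Fintype.card_fin] at this
        exact this
      have hSpos : 0 < S.card := Finset.card_pos.2 hS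
      have hn : (n : ℝ) = S.card + (r + 1) := by exact_mod_cast hScard.symm
      rw [hr, Nat.succ_sub_one, ihj (r + 1) S b hS hb hr] at hrec
      have hsum : ∑ E : Edge n with E.1 ∈ S ×ˢ Sᶜ, (if E.1.2 = b then 0 else
          ∫⁻ x, setDist (weightCost x) (insert E.1.2 S) b ^ (j + 1) ∂(expWeights n)) =
          ENNReal.ofReal (S.card * momentSeq n (j + 1) r) := by
        have h1 : ∀ E ∈ Finset.univ.filter fun E : Edge n => E.1 ∈ S ×ˢ Sᶜ,
            (if E.1.2 = b then 0 else
              ∫⁻ x, setDist (weightCost x) (insert E.1.2 S) b ^ (j + 1) ∂(expWeights n)) =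
            if E.1.2 = b then 0 else ENNReal.ofReal (momentSeq n (j + 1) r / r) := by
          intro E hE
          have hE' : E.1.1 ∈ S ∧ E.1.2 ∉ S := by simpa using hE
          split_ifs with hEb
          · rfl
          · refine ihr _ b (Finset.insert_nonempty _ _) ?_ ?_
            · simp [hb, Ne.symm hEb]
            · rw [Finset.compl_insert, Finset.card_erase_of_mem (Finset.mem_compl.2 hE'.2), hr]
              rfl
        rw [Finset.sum_congr rfl h1]
        have h2 : ∑ E : Edge n with E.1 ∈ S ×ˢ Sᶜ, (if E.1.2 = b then (0 : ℝ≥0∞) else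
            ENNReal.ofReal (momentSeq n (j + 1) r / r)) =
            ∑ e ∈ S ×ˢ Sᶜ, (if e.2 = b then (0 : ℝ≥0∞) else
            ENNReal.ofReal (momentSeq n (j + 1) r / r)) := by
          refine Finset.sum_nbij (fun E => E.1) (fun E hE => by simpa using hE)
            (fun E _ E' _ h => Subtype.ext h) (fun e he => ?_) fun _ _ => rfl
          have he' : e.1 ∈ S ∧ e.2 ∉ S := by simpa using he
          exact ⟨⟨e, fun h => he'.2 (h ▸ he'.1)⟩, by simpa using he', rfl⟩
        -- Of the `r + 1` vertices outside `S`, `b` contributes zero and the other `r` contribute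
        -- equally.
        have h3 : ∑ t ∈ Sᶜ, (if t = b then (0 : ℝ≥0∞) else
            ENNReal.ofReal (momentSeq n (j + 1) r / r)) =
            r • ENNReal.ofReal (momentSeq n (j + 1) r / r) := by
          rw [← Finset.add_sum_erase _ _ (Finset.mem_compl.2 hb), if_pos rfl, zero_add,
            Finset.sum_congr rfl fun t ht => if_neg (Finset.ne_of_mem_erase ht),
            Finset.sum_const, Finset.card_erase_of_mem (Finset.mem_compl.2 hb), hr]
          rfl
        rw [h2, Finset.sum_product]
        simp only [h3]
        rw [Finset.sum_const]
        rw [nsmul_eq_mul, nsmul_eq_mul, ← ENNReal.ofReal_natCast, ← ENNReal.ofReal_natCast,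
          ← ENNReal.ofReal_mul (by positivity), ← ENNReal.ofReal_mul (by positivity)]
        -- For `r = 0` the quotient by `r` has no meaning, but both sides vanish.
        rcases Nat.eq_zero_or_pos r with rfl | hr0
        · simp [momentSeq]
        · congr 1; field_simp
      rw [hsum, ← ENNReal.ofReal_natCast (j + 1), ← ENNReal.ofReal_mul (by positivity),
        ← ENNReal.ofReal_add] at hrec
      · have hne : ((S.card * (r + 1) : ℕ) : ℝ≥0∞) ≠ 0 := by
          rw [Nat.cast_ne_zero]; positivity
        rw [← ENNReal.mul_right_inj hne (ENNReal.natCast_ne_top _), hrec,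
          ← ENNReal.ofReal_natCast, ← ENNReal.ofReal_mul (by positivity)]
        congr 1
        have hk : (n : ℝ) - (r + 1) = S.card := by rw [hn]; ring
        rw [momentSeq, hk]
        push_cast
        have hSpos' : (0 : ℝ) < S.card := by exact_mod_cast hSpos
        field_simp
      · exact mul_nonneg (by positivity) (momentSeq_nonneg _ _ (by omega))
      · exact mul_nonneg (by positivity)
          (div_nonneg (momentSeq_nonneg _ _ (by omega)) (by positivity))

end Recursion

/-! ### Elementary estimates for the solution of the recursion. -/

section MomentBounds

variable {n : ℕ}

theorem sub_succ_pos {r : ℕ} (h : r + 1 < n) : (0 : ℝ) < n - (r + 1) := by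
  have : ((r + 1 : ℕ) : ℝ) < n := by exact_mod_cast h
  push_cast at this; linarith

theorem momentSeq_succ_succ (n j r : ℕ) : momentSeq n (j + 1) (r + 1) = momentSeq n (j + 1) r +
    (j + 1) / (((n : ℝ) - (r + 1)) * (r + 1)) * momentSeq n j (r + 1) := by
  rw [momentSeq]

theorem momentSeq_one_succ (n r : ℕ) :
    momentSeq n 1 (r + 1) = momentSeq n 1 r + 1 / ((n : ℝ) - (r + 1)) := by
  rw [momentSeq_succ_succ, momentSeq]
  congr 1
  have : (r + 1 : ℝ) ≠ 0 := by positivity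
  rcases eq_or_ne ((n : ℝ) - (r + 1)) 0 with h | h
  · simp [h]
  · push_cast; field_simp; simp

theorem momentSeq_one_le_div : ∀ r : ℕ, r < n → momentSeq n 1 r ≤ r / ((n : ℝ) - r)
  | 0, _ => by simp [momentSeq]
  | r + 1, h => by
    have h1 := momentSeq_one_le_div r (by omega)
    have h2 := sub_succ_pos h
    rw [momentSeq_one_succ]
    push_cast
    have h3 : (r : ℝ) / (n - r) ≤ r / (n - (r + 1)) := by
      gcongr; linarith
    rw [add_div]
    linarith

/-- The sequence is the sum of `1 / (n - i)` for `1 ≤ i ≤ r`. The bound telescopes by `1 / (m + 1) ≤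
log (m + 1) - log m`. -/
theorem momentSeq_one_le_log : ∀ r : ℕ, r < n →
    momentSeq n 1 r ≤ Real.log n - Real.log (n - r) + 1 / ((n : ℝ) - r) - 1 / n
  | 0, _ => by simp [momentSeq]
  | r + 1, h => by
    have h1 := momentSeq_one_le_log r (by omega)
    have h2 := sub_succ_pos h
    rw [momentSeq_one_succ]
    push_cast
    set m : ℝ := n - (r + 1) with hm
    have hm1 : (n : ℝ) - r = m + 1 := by rw [hm]; ring
    rw [hm1] at h1
    have h3 : 1 - (m + 1)⁻¹ * m ≤ Real.log (m + 1) - Real.log m := by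
      rw [← Real.log_div (by positivity) h2.ne']
      have := Real.one_sub_inv_le_log_of_pos (x := (m + 1) / m) (by positivity)
      rwa [inv_div, div_eq_inv_mul] at this
    have h4 : 1 - (m + 1)⁻¹ * m = 1 / (m + 1) := by field_simp; ring
    linarith

/-- For `r + 1 ≥ n / 2` the denominator is large; for smaller `r` the linear bound
`momentSeq_one_le_div` suffices. -/
theorem momentSeq_one_div_le {r : ℕ} (h : r + 1 < n) :
    momentSeq n 1 (r + 1) / (r + 1) ≤ 2 / n * (1 + momentSeq n 1 (r + 1)) := by
  have hA := momentSeq_nonneg 1 (r + 1) h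
  have hn : (0 : ℝ) < n := by have : 0 < n := by omega
                              exact_mod_cast this
  have hr : (0 : ℝ) < r + 1 := by positivity
  rcases le_total (n : ℝ) (2 * (r + 1)) with h1 | h1
  · calc momentSeq n 1 (r + 1) / (r + 1) ≤ momentSeq n 1 (r + 1) / (n / 2) := by
          gcongr; linarith
      _ = 2 / n * momentSeq n 1 (r + 1) := by field_simp
      _ ≤ _ := by gcongr; linarith
  · have h2 := momentSeq_one_le_div (r + 1) h
    push_cast at h2
    calc momentSeq n 1 (r + 1) / (r + 1) ≤ ((r + 1) / (n - (r + 1))) / (r + 1) := by gcongr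
      _ = 1 / (n - (r + 1)) := by field_simp
      _ ≤ 1 / (n / 2) := by gcongr; linarith
      _ = 2 / n * 1 := by field_simp
      _ ≤ _ := by gcongr; linarith

/-- Write `A r` for `momentSeq n 1 r`. The square `A r ^ 2` is the main term, to be cancelled by the
squared mean. The fraction absorbs the sum of `1 / (n - i) ^ 2` by telescoping. The last term is the
closed form of `4 / n` times the sum of `1 + A i` over `1 ≤ i ≤ r`, and its coefficient of `A`
vanishes at `r = n - 1`, where the bound is used. -/
theorem momentSeq_two_le : ∀ r : ℕ, r < n → n * momentSeq n 2 r ≤ momentSeq n 1 r ^ 2 +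
    1 / ((n : ℝ) - r - 1 / 2) + 4 / n * (2 * r - (n - r - 1) * momentSeq n 1 r)
  | 0, h => by
    have : (1 : ℝ) ≤ n := by exact_mod_cast h
    have h1 : (0 : ℝ) ≤ 1 / ((n : ℝ) - 1 / 2) := by
      apply div_nonneg zero_le_one; linarith
    simpa [momentSeq] using h1
  | r + 1, h => by
    have ih := momentSeq_two_le r (by omega)
    have h2 := sub_succ_pos h
    have hdiv := momentSeq_one_div_le h
    have hA := momentSeq_one_succ n r
    have hn : (0 : ℝ) < n := by have : 0 < n := by omega
                                exact_mod_cast this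
    -- Partial fractions: with `m = n - (r + 1)`, `n / (m * (r + 1)) = 1 / m + 1 / (r + 1)`.
    have hN : n * momentSeq n 2 (r + 1) = n * momentSeq n 2 r +
        2 * (1 / ((n : ℝ) - (r + 1))) * momentSeq n 1 (r + 1) +
        2 * (momentSeq n 1 (r + 1) / (r + 1)) := by
      rw [momentSeq_succ_succ]
      have : (r + 1 : ℝ) ≠ 0 := by positivity
      push_cast
      field_simp
      ring
    rw [hN]
    push_cast
    set m : ℝ := n - (r + 1) with hm
    have hm0 : 1 ≤ m := by
      have : ((r + 1 + 1 : ℕ) : ℝ) ≤ n := by exact_mod_cast h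
      push_cast at this; rw [hm]; linarith
    have e1 : (n : ℝ) - r - 1 / 2 = m + 1 / 2 := by rw [hm]; ring
    have e2 : (n : ℝ) - r - 1 = m := by rw [hm]; ring
    rw [e1, e2] at ih
    set A' := momentSeq n 1 (r + 1)
    have hA2 : momentSeq n 1 r = A' - 1 / m := by linarith
    rw [hA2] at ih
    have e3 : 4 / (n : ℝ) * (2 * r - m * (A' - 1 / m)) + 4 / n * (1 + A') =
        4 / n * (2 * (r + 1) - (m - 1) * A') := by
      field_simp; ring
    have e4 : (1 / m) ^ 2 ≤ 1 / (m - 1 / 2) - 1 / (m + 1 / 2) := by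
      have h5 : (0 : ℝ) < m - 1 / 2 := by linarith
      rw [div_sub_div _ _ h5.ne' (by positivity), div_pow,
        div_le_div_iff₀ (by positivity) (by positivity)]
      nlinarith
    have e5 : 2 * (A' / (r + 1)) ≤ 4 / n * (1 + A') := by
      calc 2 * (A' / (r + 1)) ≤ 2 * (2 / n * (1 + A')) := by gcongr
        _ = _ := by ring
    have e6 : (A' - 1 / m) ^ 2 + 2 * (1 / m) * A' = A' ^ 2 + (1 / m) ^ 2 := by ring
    linarith

/-- The variance of a distance in the exponential model. -/
theorem momentSeq_variance_le (hn : 2 ≤ n) :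
    momentSeq n 2 (n - 1) / (n - 1 : ℕ) - (momentSeq n 1 (n - 1) / (n - 1 : ℕ)) ^ 2 ≤
      20 / (n : ℝ) ^ 2 := by
  obtain ⟨k, rfl⟩ : ∃ k, n = k + 2 := ⟨n - 2, by omega⟩
  have h := momentSeq_two_le (n := k + 2) (k + 1) (by omega)
  have e : k + 2 - 1 = k + 1 := rfl
  rw [e]
  set N := momentSeq (k + 2) 2 (k + 1)
  set A := momentSeq (k + 2) 1 (k + 1)
  push_cast at h ⊢
  have hk : (0 : ℝ) ≤ k := k.cast_nonneg
  have e1 : (k : ℝ) + 2 - (k + 1) - 1 / 2 = 1 / 2 := by ring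
  have e2 : (k : ℝ) + 2 - (k + 1) - 1 = 0 := by ring
  rw [e1, e2] at h
  have e3 : 4 / ((k : ℝ) + 2) * (2 * (k + 1) - 0 * A) ≤ 8 := by
    rw [div_mul_eq_mul_div, div_le_iff₀ (by positivity)]; linarith
  -- The constant is `1 / (1/2) = 2` from the telescoped squares plus `8` from the last term.
  have h2 : ((k : ℝ) + 2) * N ≤ A ^ 2 + 10 := by linarith
  have h3 : N / (k + 1) ≤ (A ^ 2 + 10) / ((k + 2) * (k + 1)) := by
    rw [div_le_div_iff₀ (by positivity) (by positivity)]
    nlinarith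
  -- The squared mean dominates the main term of the second moment, so no logarithm survives in the
  -- variance.
  have h4 : (A / (k + 1)) ^ 2 ≥ A ^ 2 / ((k + 2) * (k + 1)) := by
    rw [div_pow, ge_iff_le]
    apply div_le_div_of_nonneg_left (sq_nonneg A) (by positivity)
    nlinarith
  have h5 : 10 / (((k : ℝ) + 2) * (k + 1)) ≤ 20 / (k + 2) ^ 2 := by
    rw [div_le_div_iff₀ (by positivity) (by positivity)]
    nlinarith
  rw [add_div] at h3
  linarith

/-- The increments are at most `(j + 1) * M / ((n - i) * i)`, and partial fractions turn their sum
into `momentSeq n 1 r` plus a harmonic number. Each further moment thus costs only a factor `O(log n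
/ n)`. -/
theorem momentSeq_succ_le {j : ℕ} {M : ℝ} (hM : ∀ r, r < n → momentSeq n j r ≤ M) :
    ∀ r : ℕ, r < n → momentSeq n (j + 1) r ≤
      (j + 1) * M * ((momentSeq n 1 r + (harmonic r : ℝ)) / n)
  | 0, _ => by simp [momentSeq]
  | r + 1, h => by
    have ih := momentSeq_succ_le hM r (by omega)
    have h2 := sub_succ_pos h
    have hn : (0 : ℝ) < n := by have : 0 < n := by omega
                                exact_mod_cast this
    have h3 := hM (r + 1) h
    have e : (momentSeq n 1 (r + 1) + (harmonic (r + 1) : ℝ)) / n =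
        (momentSeq n 1 r + (harmonic r : ℝ)) / n + 1 / (((n : ℝ) - (r + 1)) * (r + 1)) := by
      rw [momentSeq_one_succ, harmonic_succ]
      push_cast
      field_simp
      ring
    rw [momentSeq_succ_succ, e, mul_add ((j + 1) * M)]
    refine add_le_add ih ?_
    rw [div_mul_eq_mul_div, mul_one_div]
    gcongr

/-- The fourth moment of a distance in the exponential model. -/
theorem momentSeq_four_le (hn : 2 ≤ n) :
    momentSeq n 4 (n - 1) / (n - 1 : ℕ) ≤ 31104 * (Real.log n / n) ^ 4 := by
  have hn' : (2 : ℝ) ≤ n := by exact_mod_cast hn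
  have hlog2 : Real.log 2 ≤ Real.log n := Real.log_le_log (by norm_num) hn'
  have hl2 := Real.log_two_gt_d9
  set L := 1 + Real.log n with hL
  have hLl : L ≤ 3 * Real.log n := by linarith
  have hL0 : 0 < L := by linarith
  have h1 : ∀ r, r < n → momentSeq n 1 r ≤ L := by
    intro r hr
    have h := momentSeq_one_le_log r hr
    have hr' : (1 : ℝ) ≤ n - r := by
      have : ((r + 1 : ℕ) : ℝ) ≤ n := by exact_mod_cast hr
      push_cast at this; linarith
    have h2 : 0 ≤ Real.log (n - r) := Real.log_nonneg hr'
    have h3 : 1 / ((n : ℝ) - r) ≤ 1 := by rw [div_le_one (by linarith)]; exact hr'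
    have h4 : (0 : ℝ) ≤ 1 / n := by positivity
    linarith
  have hH : ∀ r, r < n → (harmonic r : ℝ) ≤ L := by
    intro r hr
    rcases Nat.eq_zero_or_pos r with rfl | h0
    · simpa using hL0.le
    · refine (harmonic_le_one_add_log r).trans ?_
      have : Real.log r ≤ Real.log n :=
        Real.log_le_log (by exact_mod_cast h0) (by exact_mod_cast hr.le)
      linarith
  have step : ∀ (j : ℕ) (M : ℝ), 0 ≤ M → (∀ r, r < n → momentSeq n j r ≤ M) →
      ∀ r, r < n → momentSeq n (j + 1) r ≤ (j + 1) * M * (2 * L / n) := by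
    intro j M hM h r hr
    refine (momentSeq_succ_le h r hr).trans ?_
    gcongr
    linarith [h1 r hr, hH r hr]
  have h2 := step 1 L hL0.le h1
  have h3 := step 2 _ (by positivity) h2
  have h4 := step 3 _ (by positivity) h3 (n - 1) (by omega)
  have hk : (n : ℝ) / 2 ≤ (n - 1 : ℕ) := by
    rw [Nat.cast_sub (by omega)]; push_cast; linarith
  calc momentSeq n 4 (n - 1) / (n - 1 : ℕ) ≤ momentSeq n 4 (n - 1) / (n / 2) := by
        have := momentSeq_nonneg 4 (n - 1) (by omega : n - 1 < n)
        gcongr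
    -- Three steps with factors `2 * 2`, `3 * 2` and `4 * 2` give `192`.
    _ ≤ (192 * L ^ 4 / n ^ 3) / (n / 2) := by
        gcongr
        refine h4.trans (le_of_eq ?_)
        push_cast
        field_simp
        ring
    _ = 384 * (L / n) ^ 4 := by field_simp; ring
    _ ≤ 384 * (3 * Real.log n / n) ^ 4 := by gcongr
    _ = _ := by ring

end MomentBounds

/-! ### Coupling of the exponential and the uniform model. -/

section Transfer

open scoped ENNReal

variable {n : ℕ}

theorem measurable_edgeWeight (u v : Fin n) :
    Measurable fun w : Edge n → ℝ => edgeWeight w u v := by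
  unfold edgeWeight
  split_ifs
  · exact measurable_pi_apply _
  · exact measurable_const

theorem measurable_pathLength :
    ∀ p : List (Fin n), Measurable fun w : Edge n → ℝ => pathLength w p
  | [] => measurable_const
  | [_] => measurable_const
  | u :: v :: p => (measurable_edgeWeight u v).add (measurable_pathLength (v :: p))

theorem measurable_distance (u v : Fin n) :
    Measurable fun w : Edge n → ℝ => distance w u v := by
  refine measurable_of_Iio fun r => ?_
  have : (fun w : Edge n → ℝ => distance w u v) ⁻¹' Set.Iio r =
      ⋃ p : List (Fin n), ⋃ _ : IsPath u v p, {w | pathLength w p < r} := by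
    ext w
    simp only [Set.mem_preimage, Set.mem_Iio, Set.mem_iUnion, Set.mem_ofPred_eq, exists_prop]
    constructor
    · intro h
      obtain ⟨p, hp, hp'⟩ := exists_isPath_pathLength_eq w u v
      exact ⟨p, hp, hp' ▸ h⟩
    · rintro ⟨p, hp, h⟩
      exact (distance_le_pathLength w hp).trans_lt h
  rw [this]
  exact MeasurableSet.iUnion fun p => MeasurableSet.iUnion fun _ =>
    measurableSet_lt (measurable_pathLength p) measurable_const

/-- The uniform weights corresponding to given exponential weights. -/
noncomputable def toUniform (x : Edge n → ℝ) (e : Edge n) : ℝ := 1 - Real.exp (-x e)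

/-- The map is the distribution function of the exponential law, so it pushes that law to the
uniform one. -/
theorem map_expMeasure :
    (expMeasure 1).map (fun x => 1 - Real.exp (-x)) = volume.restrict (Set.Icc 0 1) := by
  have hm : Measurable fun x : ℝ => 1 - Real.exp (-x) := by fun_prop
  have : IsProbabilityMeasure ((expMeasure 1).map fun x => 1 - Real.exp (-x)) :=
    Measure.isProbabilityMeasure_map hm.aemeasurable
  refine Measure.ext_of_Iic _ _ fun a => ?_
  rw [Measure.map_apply hm measurableSet_Iic, Measure.restrict_apply measurableSet_Iic]
  rcases lt_or_ge a 0 with ha | ha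
  · have h1 : (fun x : ℝ => 1 - Real.exp (-x)) ⁻¹' Set.Iic a ⊆ Set.Iic 0 := by
      intro x hx
      simp only [Set.mem_preimage, Set.mem_Iic] at hx ⊢
      by_contra! h
      have : Real.exp (-x) ≤ 1 := Real.exp_le_one_iff.2 (by linarith)
      linarith
    have h2 : Set.Iic a ∩ Set.Icc (0 : ℝ) 1 = ∅ := by
      ext x; simp only [Set.mem_inter_iff, Set.mem_Iic, Set.mem_Icc, Set.mem_empty_iff_false,
        iff_false]
      rintro ⟨h1, h2, -⟩; linarith
    rw [h2, measure_empty, measure_mono_null h1 expMeasure_Iic_zero]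
  · rcases lt_or_ge a 1 with ha1 | ha1
    · have h1 : (fun x : ℝ => 1 - Real.exp (-x)) ⁻¹' Set.Iic a = Set.Iic (-Real.log (1 - a)) := by
        ext x
        simp only [Set.mem_preimage, Set.mem_Iic]
        rw [sub_le_comm, ← Real.log_le_iff_le_exp (by linarith), le_neg]
      have h2 : Set.Iic a ∩ Set.Icc (0 : ℝ) 1 = Set.Icc 0 a := by
        ext x; simp only [Set.mem_inter_iff, Set.mem_Iic, Set.mem_Icc]
        constructor
        · rintro ⟨h1, h2, -⟩; exact ⟨h2, h1⟩
        · rintro ⟨h1, h2⟩; exact ⟨h2, h1, h2.trans ha1.le⟩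
      have h3 : Real.log (1 - a) ≤ 0 := Real.log_nonpos (by linarith) (by linarith)
      rw [h1, h2, ← ofReal_cdf, cdf_expMeasure_eq one_pos, if_pos (by linarith), Real.volume_Icc]
      rw [one_mul, neg_neg, Real.exp_log (by linarith)]
      congr 1; ring
    · have h1 : (fun x : ℝ => 1 - Real.exp (-x)) ⁻¹' Set.Iic a = Set.univ := by
        ext x
        simp only [Set.mem_preimage, Set.mem_Iic, Set.mem_univ, iff_true]
        linarith [Real.exp_pos (-x)]
      have h2 : Set.Iic a ∩ Set.Icc (0 : ℝ) 1 = Set.Icc 0 1 := by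
        ext x; simp only [Set.mem_inter_iff, Set.mem_Iic, Set.mem_Icc]
        exact ⟨fun h => h.2, fun h => ⟨h.2.trans ha1, h⟩⟩
      rw [h1, h2, measure_univ, Real.volume_Icc]; simp

instance : IsProbabilityMeasure ((volume : Measure ℝ).restrict (Set.Icc 0 1)) := ⟨by simp⟩

theorem measurable_toUniform : Measurable (toUniform : (Edge n → ℝ) → Edge n → ℝ) :=
  measurable_pi_lambda _ fun e => by unfold toUniform; fun_prop

theorem uniformWeights_eq_map : uniformWeights n = (expWeights n).map toUniform := by
  unfold uniformWeights expWeights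
  have hm : Measurable fun x : ℝ => 1 - Real.exp (-x) := by fun_prop
  have : SigmaFinite ((expMeasure 1).map fun x => 1 - Real.exp (-x)) := by
    rw [map_expMeasure]; infer_instance
  have h := Measure.pi_map_pi (ι := Edge n) (μ := fun _ => expMeasure 1)
    (f := fun _ x => 1 - Real.exp (-x)) (fun _ => hm.aemeasurable)
  simp_rw [map_expMeasure] at h
  exact h.symm

theorem toUniform_nonneg {x : Edge n → ℝ} (hx : ∀ e, 0 < x e) (e : Edge n) :
    0 ≤ toUniform x e := by
  have : Real.exp (-x e) ≤ 1 := Real.exp_le_one_iff.2 (by linarith [hx e])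
  unfold toUniform; linarith

theorem toUniform_le (x : Edge n → ℝ) (e : Edge n) : toUniform x e ≤ x e := by
  unfold toUniform; linarith [Real.add_one_le_exp (-x e)]

/-- This follows from `x * exp (-x) ≤ 1 - exp (-x)`, because `toUniform x e ≤ δ` means `1 - δ ≤ exp
(-x e)`. -/
theorem mul_le_toUniform {x : Edge n → ℝ} (hx : ∀ e, 0 < x e) {e : Edge n} {δ : ℝ}
    (h : toUniform x e ≤ δ) : (1 - δ) * x e ≤ toUniform x e := by
  have h1 : Real.exp (-x e) * (x e + 1) ≤ 1 := by
    calc Real.exp (-x e) * (x e + 1) ≤ Real.exp (-x e) * Real.exp (x e) := by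
          gcongr; exact Real.add_one_le_exp _
      _ = 1 := by rw [← Real.exp_add]; simp
  have h2 : (1 - δ) * x e ≤ Real.exp (-x e) * x e := by
    have := (hx e).le
    gcongr
    unfold toUniform at h; linarith
  unfold toUniform; linarith

theorem mul_pathLength_le_toUniform {x : Edge n → ℝ} (hx : ∀ e, 0 < x e) {δ : ℝ} :
    ∀ p : List (Fin n), pathLength (toUniform x) p ≤ δ →
      (1 - δ) * pathLength x p ≤ pathLength (toUniform x) p
  | [], _ => by simp [pathLength]
  | [_], _ => by simp [pathLength]
  | u :: v :: p, h => by
    rw [pathLength_cons_cons] at h ⊢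
    have h1 := pathLength_nonneg (toUniform_nonneg hx) (v :: p)
    have h2 := edgeWeight_nonneg (toUniform_nonneg hx) u v
    rw [pathLength_cons_cons, mul_add]
    refine add_le_add ?_ (mul_pathLength_le_toUniform hx (v :: p) (by linarith))
    have h3 : edgeWeight (toUniform x) u v ≤ δ := by linarith
    unfold edgeWeight at h3 ⊢
    split_ifs with huv
    · rw [dif_pos huv] at h3
      exact mul_le_toUniform hx h3
    · simp

/-- Every edge of the uniform shortest path is at most the uniform distance `δ`, so its exponential
length is at most `1 / (1 - δ)` times `δ`. Hence the loss is at most `δ * distance x a b`. -/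
theorem distance_sub_toUniform_le {x : Edge n → ℝ} (hx : ∀ e, 0 < x e) {a b : Fin n}
    (hab : a ≠ b) : distance x a b - distance (toUniform x) a b ≤ distance x a b ^ 2 := by
  have h1 : distance (toUniform x) a b < 1 := by
    refine (distance_le_edge _ hab).trans_lt ?_
    unfold toUniform; linarith [Real.exp_pos (-x ⟨(a, b), hab⟩)]
  have h2 := distance_mono (toUniform_le x) a b
  have h0 := distance_nonneg (fun e => (hx e).le) a b
  obtain ⟨p, hp, hpl⟩ := exists_isPath_pathLength_eq (toUniform x) a b
  have h3 := mul_pathLength_le_toUniform hx p hpl.le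
  rw [hpl] at h3
  have h4 : (1 - distance (toUniform x) a b) * distance x a b ≤
      (1 - distance (toUniform x) a b) * pathLength x p :=
    mul_le_mul_of_nonneg_left (distance_le_pathLength x hp) (by linarith)
  nlinarith

theorem lintegral_distance_pow {a b : Fin n} (hab : a ≠ b) (j : ℕ) :
    ∫⁻ x, ENNReal.ofReal (distance x a b ^ j) ∂(expWeights n) =
      ENNReal.ofReal (momentSeq n j (n - 1) / (n - 1 : ℕ)) := by
  rw [← lintegral_setDist_pow j (n - 1) {a} b (Finset.singleton_nonempty a)
    (by simpa using hab.symm) (by simp [Finset.card_compl])]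
  refine lintegral_congr_ae (ae_expWeights_pos.mono fun x hx => ?_)
  simp only
  rw [setDist_singleton (fun e => (hx e).le) hab,
    ENNReal.ofReal_pow (distance_nonneg (fun e => (hx e).le) a b)]

theorem two_le_of_ne {a b : Fin n} (hab : a ≠ b) : 2 ≤ n := by
  have h1 := a.2
  have h2 := b.2
  have : (a : ℕ) ≠ b := fun h => hab (Fin.ext h)
  omega

theorem lintegral_distance_sub_sq_le {a b : Fin n} (hab : a ≠ b) :
    ∫⁻ x, ENNReal.ofReal ((distance x a b - momentSeq n 1 (n - 1) / (n - 1 : ℕ)) ^ 2)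
      ∂(expWeights n) ≤ ENNReal.ofReal (20 / (n : ℝ) ^ 2) := by
  have hn := two_le_of_ne hab
  have h1 := lintegral_distance_pow hab 1
  have h2 := lintegral_distance_pow hab 2
  have hv := momentSeq_variance_le hn
  have hm : 0 ≤ momentSeq n 1 (n - 1) / (n - 1 : ℕ) :=
    div_nonneg (momentSeq_nonneg _ _ (by omega)) (by positivity)
  have hs : 0 ≤ momentSeq n 2 (n - 1) / (n - 1 : ℕ) :=
    div_nonneg (momentSeq_nonneg _ _ (by omega)) (by positivity)
  set m := momentSeq n 1 (n - 1) / (n - 1 : ℕ)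
  set s := momentSeq n 2 (n - 1) / (n - 1 : ℕ)
  have hd := measurable_distance a b
  -- The expanded square, with the cross term moved across so that all integrands are nonnegative.
  have key : ∫⁻ x, ENNReal.ofReal ((distance x a b - m) ^ 2) ∂(expWeights n) +
      ENNReal.ofReal (2 * m * m) = ENNReal.ofReal (s + m ^ 2) := by
    rw [ENNReal.ofReal_mul (by positivity), ← h1, ← lintegral_const_mul _ (by fun_prop),
      ← lintegral_add_left (by fun_prop), ENNReal.ofReal_add hs (sq_nonneg m), ← h2]
    have : ENNReal.ofReal (m ^ 2) = ∫⁻ _, ENNReal.ofReal (m ^ 2) ∂(expWeights n) := by simp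
    rw [this, ← lintegral_add_left (by fun_prop)]
    refine lintegral_congr_ae (ae_expWeights_pos.mono fun x hx => ?_)
    have h0 := distance_nonneg (fun e => (hx e).le) a b
    simp only
    rw [← ENNReal.ofReal_mul (by positivity), ← ENNReal.ofReal_add (by positivity) (by positivity),
      ← ENNReal.ofReal_add (by positivity) (by positivity)]
    congr 1; ring
  have h3 : ∫⁻ x, ENNReal.ofReal ((distance x a b - m) ^ 2) ∂(expWeights n) =
      ENNReal.ofReal (s + m ^ 2) - ENNReal.ofReal (2 * m * m) :=
    ENNReal.eq_sub_of_add_eq ENNReal.ofReal_ne_top key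
  rw [h3, ← ENNReal.ofReal_sub _ (by positivity)]
  refine ENNReal.ofReal_le_ofReal ?_
  nlinarith

/-- A crude form of `log n ≤ 2 * √n`, enough to make `(log n / n) ^ 4` of order `1 / n ^ 2`. -/
theorem log_pow_four_le (hn : 1 ≤ n) : Real.log n ^ 4 ≤ 16 * (n : ℝ) ^ 2 := by
  have hn' : (1 : ℝ) ≤ n := by exact_mod_cast hn
  have h0 : 0 ≤ Real.log n := Real.log_nonneg hn'
  have hs : 0 < √(n : ℝ) := Real.sqrt_pos.2 (by linarith)
  have h1 : Real.log n ≤ 2 * √n := by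
    have h2 := Real.log_le_sub_one_of_pos hs
    rw [Real.log_sqrt (by linarith)] at h2
    linarith
  calc Real.log n ^ 4 ≤ (2 * √n) ^ 4 := by gcongr
    _ = 16 * (√n ^ 2) ^ 2 := by ring
    _ = 16 * (n : ℝ) ^ 2 := by rw [Real.sq_sqrt (by linarith)]

theorem lintegral_uniform_distance_pow_four_le {a b : Fin n} (hab : a ≠ b) :
    ∫⁻ w, ENNReal.ofReal (distance w a b ^ 4) ∂(uniformWeights n) ≤
      ENNReal.ofReal (31104 * (Real.log n / n) ^ 4) := by
  have hn := two_le_of_ne hab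
  have hd := measurable_distance a b
  rw [uniformWeights_eq_map, lintegral_map (by fun_prop) measurable_toUniform]
  refine le_trans ?_ (ENNReal.ofReal_le_ofReal (momentSeq_four_le hn))
  rw [← lintegral_distance_pow hab 4]
  refine lintegral_mono_ae (ae_expWeights_pos.mono fun x hx => ENNReal.ofReal_le_ofReal ?_)
  have h0 := distance_nonneg (toUniform_nonneg hx) a b
  gcongr
  exact distance_mono (toUniform_le x) a b

theorem lintegral_uniform_distance_pow_four_le' {a b : Fin n} (hab : a ≠ b) :
    ∫⁻ w, ENNReal.ofReal (distance w a b ^ 4) ∂(uniformWeights n) ≤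
      ENNReal.ofReal (497664 / (n : ℝ) ^ 2) := by
  refine (lintegral_uniform_distance_pow_four_le hab).trans (ENNReal.ofReal_le_ofReal ?_)
  have hn := two_le_of_ne hab
  have h := log_pow_four_le (n := n) (by omega)
  have hn' : (0 : ℝ) < n := by have : 0 < n := by omega
                               exact_mod_cast this
  rw [div_pow, ← mul_div_assoc, div_le_div_iff₀ (by positivity) (by positivity)]
  calc 31104 * Real.log n ^ 4 * (n : ℝ) ^ 2 ≤ 31104 * (16 * (n : ℝ) ^ 2) * n ^ 2 := by gcongr
    _ = _ := by ring

/-- All distances are concentrated in a window of width `1 / n` around a common value. -/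
theorem exists_lintegral_uniform_distance_sub_sq_le (n : ℕ) : ∃ m : ℝ, ∀ a b : Fin n, a ≠ b →
    ∫⁻ w, ENNReal.ofReal ((distance w a b - m) ^ 2) ∂(uniformWeights n) ≤
      ENNReal.ofReal (2000000 / (n : ℝ) ^ 2) := by
  refine ⟨momentSeq n 1 (n - 1) / (n - 1 : ℕ), fun a b hab => ?_⟩
  have hn := two_le_of_ne hab
  have hd := measurable_distance a b
  have h2 := lintegral_distance_sub_sq_le hab
  set m := momentSeq n 1 (n - 1) / (n - 1 : ℕ)
  have hn' : (0 : ℝ) < n := by have : 0 < n := by omega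
                               exact_mod_cast this
  have h4 : ∫⁻ x, ENNReal.ofReal (distance x a b ^ 4) ∂(expWeights n) ≤
      ENNReal.ofReal (497664 / (n : ℝ) ^ 2) := by
    rw [lintegral_distance_pow hab 4]
    refine ENNReal.ofReal_le_ofReal ((momentSeq_four_le hn).trans ?_)
    have h := log_pow_four_le (n := n) (by omega)
    rw [div_pow, ← mul_div_assoc, div_le_div_iff₀ (by positivity) (by positivity)]
    calc 31104 * Real.log n ^ 4 * (n : ℝ) ^ 2 ≤ 31104 * (16 * (n : ℝ) ^ 2) * n ^ 2 := by gcongr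
      _ = _ := by ring
  rw [uniformWeights_eq_map, lintegral_map (by fun_prop) measurable_toUniform]
  calc ∫⁻ x, ENNReal.ofReal ((distance (toUniform x) a b - m) ^ 2) ∂(expWeights n)
      ≤ ∫⁻ x, (ENNReal.ofReal 2 * ENNReal.ofReal ((distance x a b - m) ^ 2) +
          ENNReal.ofReal 2 * ENNReal.ofReal (distance x a b ^ 4)) ∂(expWeights n) := by
        refine lintegral_mono_ae (ae_expWeights_pos.mono fun x hx => ?_)
        rw [← ENNReal.ofReal_mul zero_le_two, ← ENNReal.ofReal_mul zero_le_two,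
          ← ENNReal.ofReal_add (by positivity) (by positivity)]
        refine ENNReal.ofReal_le_ofReal ?_
        -- With `D`, `U` the exponential and uniform distances, `(U - m)² ≤ 2 (D - m)² + 2 (D - U)²`
        -- and `(D - U)² ≤ D⁴`.
        have h5 := distance_sub_toUniform_le hx hab
        have h6 := distance_mono (toUniform_le x) a b
        have h7 : (distance x a b - distance (toUniform x) a b) ^ 2 ≤ (distance x a b ^ 2) ^ 2 :=
          pow_le_pow_left₀ (by linarith) h5 2
        nlinarith [sq_nonneg (distance x a b - m +
          (distance x a b - distance (toUniform x) a b))]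
    _ ≤ ENNReal.ofReal 2 * ENNReal.ofReal (20 / (n : ℝ) ^ 2) +
        ENNReal.ofReal 2 * ENNReal.ofReal (497664 / (n : ℝ) ^ 2) := by
        rw [lintegral_add_left (by fun_prop), lintegral_const_mul _ (by fun_prop),
          lintegral_const_mul _ (by fun_prop)]
        gcongr
    _ ≤ ENNReal.ofReal (2000000 / (n : ℝ) ^ 2) := by
        rw [← ENNReal.ofReal_mul zero_le_two, ← ENNReal.ofReal_mul zero_le_two,
          ← ENNReal.ofReal_add (by positivity) (by positivity)]
        refine ENNReal.ofReal_le_ofReal ?_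
        rw [mul_div_assoc', mul_div_assoc', ← add_div]
        gcongr
        norm_num

end Transfer

/-! ### Probabilities of locally shortest paths, and the variance, under uniform weights. -/

section UniformWeights

open scoped ENNReal

variable {n : ℕ}

theorem ae_uniformWeights_mem : ∀ᵐ w ∂(uniformWeights n), ∀ e, w e ∈ Set.Icc (0 : ℝ) 1 :=
  ae_all_iff.2 fun _ => Measure.tendsto_eval_ae_ae.eventually
    (ae_restrict_mem measurableSet_Icc)

/-- The weights with the weights of two edges raised to one. -/
def raise (w : Edge n → ℝ) (e₁ e₂ : Edge n) : Edge n → ℝ :=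
  Function.update (Function.update w e₁ 1) e₂ 1

theorem measurable_raise (e₁ e₂ : Edge n) : Measurable fun w : Edge n → ℝ => raise w e₁ e₂ :=
  measurable_update_left.comp measurable_update_left

theorem raise_apply (w : Edge n → ℝ) (e₁ e₂ e : Edge n) :
    raise w e₁ e₂ e = if e = e₁ ∨ e = e₂ then 1 else w e := by
  unfold raise
  simp only [Function.update_apply]
  split_ifs <;> tauto

theorem raise_update_update (w : Edge n → ℝ) (e₁ e₂ : Edge n) (y z : ℝ) :
    raise (Function.update (Function.update w e₁ y) e₂ z) e₁ e₂ = raise w e₁ e₂ := by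
  ext e
  simp only [raise_apply, Function.update_apply]
  split_ifs <;> tauto

theorem lintegral_uniform_update_update (e₁ e₂ : Edge n) {f : (Edge n → ℝ) → ℝ≥0∞}
    (hf : Measurable f) : ∫⁻ w, f w ∂(uniformWeights n) =
      ∫⁻ w, (∫⁻ y in Set.Icc (0 : ℝ) 1, ∫⁻ z in Set.Icc (0 : ℝ) 1,
        f (Function.update (Function.update w e₁ y) e₂ z)) ∂(uniformWeights n) := by
  unfold uniformWeights
  rw [lintegral_pi_eq_lintegral_update _ e₂ hf, lintegral_pi_eq_lintegral_update _ e₁]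
  exact Measurable.lintegral_prod_right' (f := fun p : (Edge n → ℝ) × ℝ =>
    f (Function.update p.1 e₂ p.2)) (hf.comp measurable_update')

theorem indicator_eq_mul_indicator {α : Type*} {s : Set α} {x : α} {A B : Set ℝ} {y z : ℝ}
    (h : x ∈ s ↔ y ∈ A ∧ z ∈ B) (H : α → ℝ≥0∞) :
    s.indicator H x = H x * (A.indicator 1 y * B.indicator 1 z) := by
  by_cases hy : y ∈ A <;> by_cases hz : z ∈ B <;> simp [Set.indicator, h, hy, hz]

theorem uniform_Iic_le (t : ℝ) :
    (volume : Measure ℝ).restrict (Set.Icc 0 1) (Set.Iic t) ≤ ENNReal.ofReal t := by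
  rw [Measure.restrict_apply measurableSet_Iic]
  refine (measure_mono (t := Set.Icc 0 t) fun x hx => ⟨hx.2.1, hx.1⟩).trans ?_
  simp

theorem uniform_Ici_half :
    (volume : Measure ℝ).restrict (Set.Icc 0 1) (Set.Ici (1 / 2)) = ENNReal.ofReal (1 / 2) := by
  rw [Measure.restrict_apply measurableSet_Ici]
  have : Set.Ici (1 / 2 : ℝ) ∩ Set.Icc 0 1 = Set.Icc (1 / 2) 1 := by
    ext x; simp only [Set.mem_inter_iff, Set.mem_Ici, Set.mem_Icc]
    constructor
    · rintro ⟨h1, -, h2⟩; exact ⟨h1, h2⟩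
    · rintro ⟨h1, h2⟩; exact ⟨h1, by linarith, h2⟩
  rw [this, Real.volume_Icc]; norm_num

/-- The probability that two edges are shorter than quantities that depend on the other edges
only. -/
theorem uniformWeights_two_edges_le {e₁ e₂ : Edge n} (he : e₁ ≠ e₂) {F G : (Edge n → ℝ) → ℝ}
    (hF : Measurable F) (hG : Measurable G) {Q : (Edge n → ℝ) → ℝ≥0∞}
    (hQ : ∀ w : Edge n → ℝ, (∀ e, w e ∈ Set.Icc (0 : ℝ) 1) → 1 / 2 ≤ w e₁ → 1 / 2 ≤ w e₂ →
      ENNReal.ofReal (F (raise w e₁ e₂)) * ENNReal.ofReal (G (raise w e₁ e₂)) ≤ Q w) :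
    uniformWeights n {w | w e₁ ≤ F (raise w e₁ e₂) ∧ w e₂ ≤ G (raise w e₁ e₂)} ≤
      4 * ∫⁻ w, Q w ∂(uniformWeights n) := by
  have hr := measurable_raise e₁ e₂
  have hFr := hF.comp hr
  have hGr := hG.comp hr
  set H : (Edge n → ℝ) → ℝ≥0∞ := fun w =>
    ENNReal.ofReal (F (raise w e₁ e₂)) * ENNReal.ofReal (G (raise w e₁ e₂)) with hH
  have hHm : Measurable H := hFr.ennreal_ofReal.mul hGr.ennreal_ofReal
  set s : Set (Edge n → ℝ) := {w | w e₁ ≤ F (raise w e₁ e₂) ∧ w e₂ ≤ G (raise w e₁ e₂)} with hs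
  have hsm : MeasurableSet s := (measurableSet_le (measurable_pi_apply e₁) hFr).inter
    (measurableSet_le (measurable_pi_apply e₂) hGr)
  set t : Set (Edge n → ℝ) := {w | 1 / 2 ≤ w e₁ ∧ 1 / 2 ≤ w e₂} with ht
  have htm : MeasurableSet t :=
    (measurableSet_le measurable_const (measurable_pi_apply e₁)).inter
    (measurableSet_le measurable_const (measurable_pi_apply e₂))
  have hy : ∀ (w : Edge n → ℝ) (y z : ℝ),
      Function.update (Function.update w e₁ y) e₂ z e₁ = y := by
    intro w y z; rw [Function.update_of_ne he, Function.update_self]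
  have hz : ∀ (w : Edge n → ℝ) (y z : ℝ),
      Function.update (Function.update w e₁ y) e₂ z e₂ = z := by
    intro w y z; rw [Function.update_self]
  -- Given the other edges, the two bounds are constants and the two weights are independent and
  -- uniform.
  have h1 : uniformWeights n s ≤ ∫⁻ w, H w ∂(uniformWeights n) := by
    rw [← lintegral_indicator_one hsm,
      lintegral_uniform_update_update e₁ e₂ (measurable_one.indicator hsm)]
    refine lintegral_mono fun w => ?_
    have h : ∀ y z, s.indicator (1 : (Edge n → ℝ) → ℝ≥0∞)
        (Function.update (Function.update w e₁ y) e₂ z) =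
        (Set.Iic (F (raise w e₁ e₂))).indicator 1 y *
          (Set.Iic (G (raise w e₁ e₂))).indicator 1 z := by
      intro y z
      have hmem : Function.update (Function.update w e₁ y) e₂ z ∈ s ↔
          y ∈ Set.Iic (F (raise w e₁ e₂)) ∧ z ∈ Set.Iic (G (raise w e₁ e₂)) := by
        rw [hs, Set.mem_ofPred_eq, raise_update_update, hy, hz, Set.mem_Iic, Set.mem_Iic]
      rw [indicator_eq_mul_indicator hmem, Pi.one_apply, one_mul]
    simp_rw [h]
    simp_rw [lintegral_const_mul _ (measurable_one.indicator measurableSet_Iic)]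
    rw [lintegral_mul_const _ (measurable_one.indicator measurableSet_Iic),
      lintegral_indicator_one measurableSet_Iic, lintegral_indicator_one measurableSet_Iic]
    exact mul_le_mul' (uniform_Iic_le _) (uniform_Iic_le _)
  -- `H` ignores the two edges, so it is independent of the event that both weights are at least
  -- `1/2`, of probability `1/4`. On that event raising them changes little, which is why `hQ` is
  -- required only there.
  have h2 : ∫⁻ w, t.indicator H w ∂(uniformWeights n) =
      ENNReal.ofReal (1 / 4) * ∫⁻ w, H w ∂(uniformWeights n) := by
    rw [lintegral_uniform_update_update e₁ e₂ (hHm.indicator htm), ← lintegral_const_mul _ hHm]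
    refine lintegral_congr fun w => ?_
    have h : ∀ y z, t.indicator H (Function.update (Function.update w e₁ y) e₂ z) =
        H w * ((Set.Ici (1 / 2 : ℝ)).indicator 1 y * (Set.Ici (1 / 2 : ℝ)).indicator 1 z) := by
      intro y z
      have hmem : Function.update (Function.update w e₁ y) e₂ z ∈ t ↔
          y ∈ Set.Ici (1 / 2 : ℝ) ∧ z ∈ Set.Ici (1 / 2 : ℝ) := by
        rw [ht, Set.mem_ofPred_eq, hy, hz, Set.mem_Ici, Set.mem_Ici]
      rw [indicator_eq_mul_indicator hmem, hH]
      simp only [raise_update_update]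
    simp_rw [h]
    have hI : Measurable ((Set.Ici (1 / 2 : ℝ)).indicator (1 : ℝ → ℝ≥0∞)) :=
      measurable_one.indicator measurableSet_Ici
    simp_rw [lintegral_const_mul _ (hI.const_mul _), lintegral_const_mul _ hI]
    rw [lintegral_const_mul _ (hI.mul_const _), lintegral_mul_const _ hI,
      lintegral_indicator_one measurableSet_Ici, uniform_Ici_half,
      ← ENNReal.ofReal_mul (by norm_num), mul_comm]
    norm_num
  have h3 : ∫⁻ w, t.indicator H w ∂(uniformWeights n) ≤ ∫⁻ w, Q w ∂(uniformWeights n) := by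
    refine lintegral_mono_ae (ae_uniformWeights_mem.mono fun w hw => ?_)
    by_cases hwt : w ∈ t
    · rw [Set.indicator_of_mem hwt]; exact hQ w hw hwt.1 hwt.2
    · rw [Set.indicator_of_notMem hwt]; exact zero_le
  refine h1.trans ?_
  have h4 : ∫⁻ w, H w ∂(uniformWeights n) =
      4 * (ENNReal.ofReal (1 / 4) * ∫⁻ w, H w ∂(uniformWeights n)) := by
    rw [← mul_assoc, ← ENNReal.ofReal_ofNat 4, ← ENNReal.ofReal_mul (by norm_num)]
    norm_num
  rw [h4, ← h2]
  gcongr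

theorem le_raise {w : Edge n → ℝ} (hw : ∀ e, w e ∈ Set.Icc (0 : ℝ) 1) (e₁ e₂ e : Edge n) :
    w e ≤ raise w e₁ e₂ e := by
  rw [raise_apply]; split_ifs
  · exact (hw e).2
  · exact le_rfl

theorem raise_le_one {w : Edge n → ℝ} (hw : ∀ e, w e ∈ Set.Icc (0 : ℝ) 1) (e₁ e₂ e : Edge n) :
    raise w e₁ e₂ e ≤ 1 := by
  rw [raise_apply]; split_ifs
  · exact le_rfl
  · exact (hw e).2

theorem raise_le_two_mul {w : Edge n → ℝ} (hw : ∀ e, w e ∈ Set.Icc (0 : ℝ) 1) {e₁ e₂ : Edge n}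
    (h₁ : 1 / 2 ≤ w e₁) (h₂ : 1 / 2 ≤ w e₂) (e : Edge n) : raise w e₁ e₂ e ≤ 2 * w e := by
  rw [raise_apply]; split_ifs with h
  · rcases h with rfl | rfl <;> linarith
  · linarith [(hw e).1]

/-- A shortest path of length below `1/2` avoids both heavy edges, so raising them does not lengthen
it. Otherwise `4 * distance w a b ^ 2 ≥ 1` exceeds any raised distance. A bound by a constant
multiple would spoil differences of distances, hence the quadratic error. -/
theorem distance_raise_le {w : Edge n → ℝ} (hw : ∀ e, w e ∈ Set.Icc (0 : ℝ) 1) {e₁ e₂ : Edge n}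
    (h₁ : 1 / 2 ≤ w e₁) (h₂ : 1 / 2 ≤ w e₂) {a b : Fin n} (hab : a ≠ b) :
    distance (raise w e₁ e₂) a b ≤ distance w a b + 4 * distance w a b ^ 2 := by
  have h0 := distance_nonneg (fun e => (hw e).1) a b
  rcases le_or_gt (1 / 2) (distance w a b) with h | h
  · have := (distance_le_edge (raise w e₁ e₂) hab).trans (raise_le_one hw e₁ e₂ _)
    nlinarith
  · obtain ⟨p, hp, hpl⟩ := exists_isPath_pathLength_eq w a b
    have hinf : ∀ e : Edge n, 1 / 2 ≤ w e → ¬ [e.1.1, e.1.2] <:+: p := by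
      intro e he hinf
      have := edgeWeight_le_pathLength (fun e => (hw e).1) p hinf
      rw [edgeWeight_of_ne w e.2, hpl] at this
      exact absurd (he.trans this) (not_le.2 h)
    have : pathLength (raise w e₁ e₂) p = pathLength w p := by
      unfold raise
      rw [pathLength_update_of_not_infix _ _ (hinf e₂ h₂),
        pathLength_update_of_not_infix _ _ (hinf e₁ h₁)]
    have h3 := distance_le_pathLength (raise w e₁ e₂) hp
    rw [this, hpl] at h3
    nlinarith [sq_nonneg (distance w a b)]

theorem IsShortestPath.of_exists {w : Edge n → ℝ} {p : List (Fin n)} {a b : Fin n}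
    (h : ∃ u v, IsShortestPath w u v p) (ha : p.head? = some a) (hb : p.getLast? = some b) :
    IsShortestPath w a b p := by
  obtain ⟨u, v, h⟩ := h
  have hu : u = a := by have := h.1.1; rw [ha] at this; simpa using this.symm
  have hv : v = b := by have := h.1.2.1; rw [hb] at this; simpa using this.symm
  rwa [hu, hv] at h

/-- Each edge of the path must be a shortest path between its own endpoints; the multiplicative
comparison after raising is enough here. -/
theorem prob_isLSP_triple_le {a b c : Fin n} (hab : a ≠ b) (hbc : b ≠ c) :
    (uniformWeights n).real {w | IsLSP w [a, b, c]} ≤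
      300000 * (Real.log n ^ 2 / (n : ℝ) ^ 2) := by
  have hn : 2 ≤ n := two_le_of_ne hab
  have hn' : (2 : ℝ) ≤ n := by exact_mod_cast hn
  set ℓ : ℝ := Real.log n / n with hℓ
  have hℓ0 : 0 < ℓ := div_pos (Real.log_pos (by linarith)) (by linarith)
  set e₁ : Edge n := ⟨(a, b), hab⟩
  set e₂ : Edge n := ⟨(b, c), hbc⟩
  have he : e₁ ≠ e₂ := fun h => hab (congrArg (fun e : Edge n => e.1.1) h)
  have hd1 := measurable_distance a b
  have hd2 := measurable_distance b c
  have h := uniformWeights_two_edges_le he hd1 hd2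
    (Q := fun w => ENNReal.ofReal (1 / ℓ ^ 2) * ENNReal.ofReal (distance w a b ^ 4) +
      ENNReal.ofReal (1 / ℓ ^ 2) * ENNReal.ofReal (distance w b c ^ 4) +
      ENNReal.ofReal (2 * ℓ ^ 2)) (by
    intro w hw h₁ h₂
    have h0 := distance_nonneg (fun e => (hw e).1)
    have hle := distance_le_mul (raise_le_two_mul hw h₁ h₂)
    have h0' := distance_nonneg (fun e => (hw e).1.trans (le_raise hw e₁ e₂ e))
    rw [← ENNReal.ofReal_mul (h0' a b), ← ENNReal.ofReal_mul (by positivity),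
      ← ENNReal.ofReal_mul (by positivity), ← ENNReal.ofReal_add (by positivity) (by positivity),
      ← ENNReal.ofReal_add (by positivity) (by positivity)]
    refine ENNReal.ofReal_le_ofReal ?_
    have h5 : distance (raise w e₁ e₂) a b * distance (raise w e₁ e₂) b c ≤
        (2 * distance w a b) * (2 * distance w b c) :=
      mul_le_mul (hle a b) (hle b c) (h0' b c) (by linarith [h0 a b])
    -- Weighted at the typical scale `ℓ = log n / n`, this brings second moments down to the
    -- fourth-moment bound.
    have h6 : ∀ D : ℝ, 2 * D ^ 2 ≤ 1 / ℓ ^ 2 * D ^ 4 + ℓ ^ 2 := by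
      intro D
      have h7 := sq_nonneg (D ^ 2 / ℓ - ℓ)
      have h8 : (D ^ 2 / ℓ - ℓ) ^ 2 = 1 / ℓ ^ 2 * D ^ 4 - 2 * D ^ 2 + ℓ ^ 2 := by
        field_simp
        ring
      linarith
    nlinarith [h6 (distance w a b), h6 (distance w b c),
      sq_nonneg (distance w a b - distance w b c)])
  have hsub : uniformWeights n {w | IsLSP w [a, b, c]} ≤ uniformWeights n
      {w | w e₁ ≤ distance (raise w e₁ e₂) a b ∧ w e₂ ≤ distance (raise w e₁ e₂) b c} := by
    refine measure_mono_ae (ae_uniformWeights_mem.mono fun w hw hl => ?_)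
    obtain ⟨-, -, ht, hd⟩ := hl
    have ht' := (IsShortestPath.of_exists (a := b) (b := c) ht rfl rfl).pathLength_eq
    have hd' := (IsShortestPath.of_exists (a := a) (b := b) hd rfl rfl).pathLength_eq
    simp only [List.tail_cons, List.dropLast, pathLength, add_zero] at ht' hd'
    rw [edgeWeight_of_ne w hbc] at ht'
    rw [edgeWeight_of_ne w hab] at hd'
    have hm := distance_mono (le_raise hw e₁ e₂)
    exact ⟨hd'.trans_le (hm a b), ht'.trans_le (hm b c)⟩
  refine ENNReal.toReal_le_of_le_ofReal (by positivity) ((hsub.trans h).trans ?_)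
  rw [lintegral_add_left (by fun_prop), lintegral_add_left (by fun_prop),
    lintegral_const_mul _ (by fun_prop), lintegral_const_mul _ (by fun_prop), lintegral_const,
    measure_univ, mul_one]
  have hD : ∀ u v : Fin n, u ≠ v → ENNReal.ofReal (1 / ℓ ^ 2) *
      ∫⁻ w, ENNReal.ofReal (distance w u v ^ 4) ∂(uniformWeights n) ≤
      ENNReal.ofReal (31104 * ℓ ^ 2) := by
    intro u v huv
    refine (mul_le_mul_right (lintegral_uniform_distance_pow_four_le huv) _).trans ?_
    rw [← ENNReal.ofReal_mul (by positivity)]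
    refine ENNReal.ofReal_le_ofReal (le_of_eq ?_)
    rw [← hℓ]; field_simp
  calc _ ≤ 4 * (ENNReal.ofReal (31104 * ℓ ^ 2) + ENNReal.ofReal (31104 * ℓ ^ 2) +
        ENNReal.ofReal (2 * ℓ ^ 2)) := by
        gcongr
        · exact hD a b hab
        · exact hD b c hbc
    _ ≤ _ := by
        rw [← ENNReal.ofReal_add (by positivity) (by positivity),
          ← ENNReal.ofReal_add (by positivity) (by positivity), ← ENNReal.ofReal_ofNat 4,
          ← ENNReal.ofReal_mul (by norm_num)]
        refine ENNReal.ofReal_le_ofReal ?_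
        rw [← div_pow, ← hℓ]
        nlinarith [sq_nonneg ℓ]

/-- Local shortestness makes each outer edge weight equal to a difference of two distances, and
these have the same centre `m`. -/
theorem prob_isLSPVia_le {a b c d : Fin n} (hab : a ≠ b) (hac : a ≠ c) (hbc : b ≠ c)
    (hbd : b ≠ d) (hcd : c ≠ d) :
    (uniformWeights n).real {w | IsLSPVia w a b c d} ≤ 200000000 * (1 / (n : ℝ) ^ 2) := by
  obtain ⟨m, hm⟩ := exists_lintegral_uniform_distance_sub_sq_le n
  set e₁ : Edge n := ⟨(a, b), hab⟩
  set e₂ : Edge n := ⟨(c, d), hcd⟩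
  have he : e₁ ≠ e₂ := fun h => hac (congrArg (fun e : Edge n => e.1.1) h)
  have hd1 := measurable_distance a c
  have hd2 := measurable_distance b c
  have hd3 := measurable_distance b d
  have hbcr : ∀ w : Edge n → ℝ, distance (raise w e₁ e₂) b c = distance w b c := by
    intro w
    unfold raise
    rw [distance_update_of_fst_eq _ e₂ 1 b rfl, distance_update_of_snd_eq _ e₁ 1 c rfl]
  have h := uniformWeights_two_edges_le he (hd1.sub hd2) (hd3.sub hd2)
    (Q := fun w => ENNReal.ofReal 2 * ENNReal.ofReal ((distance w a c - m) ^ 2) +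
      ENNReal.ofReal 4 * ENNReal.ofReal ((distance w b c - m) ^ 2) +
      ENNReal.ofReal 2 * ENNReal.ofReal ((distance w b d - m) ^ 2) +
      ENNReal.ofReal 16 * ENNReal.ofReal (distance w a c ^ 4) +
      ENNReal.ofReal 16 * ENNReal.ofReal (distance w b d ^ 4)) (by
    intro w hw h₁ h₂
    have hac' := distance_raise_le hw h₁ h₂ hac
    have hbd' := distance_raise_le hw h₁ h₂ hbd
    simp only [Pi.sub_apply]
    rw [hbcr]
    set x := distance w a c
    set y := distance w b c
    set z := distance w b d
    set X := distance (raise w e₁ e₂) a c - y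
    set Y := distance (raise w e₁ e₂) b d - y
    rcases le_or_gt X 0 with hX | hX
    -- A nonpositive bound contributes nothing after truncation, so squaring is only needed for
    -- positive `X` and `Y`.
    · rw [ENNReal.ofReal_of_nonpos hX, zero_mul]; exact zero_le
    rcases le_or_gt Y 0 with hY | hY
    · rw [ENNReal.ofReal_of_nonpos hY, mul_zero]; exact zero_le
    rw [← ENNReal.ofReal_mul hX.le, ← ENNReal.ofReal_mul (by positivity),
      ← ENNReal.ofReal_mul (by positivity), ← ENNReal.ofReal_mul (by positivity),
      ← ENNReal.ofReal_mul (by positivity), ← ENNReal.ofReal_mul (by positivity),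
      ← ENNReal.ofReal_add (by positivity) (by positivity),
      ← ENNReal.ofReal_add (by positivity) (by positivity),
      ← ENNReal.ofReal_add (by positivity) (by positivity),
      ← ENNReal.ofReal_add (by positivity) (by positivity)]
    refine ENNReal.ofReal_le_ofReal ?_
    -- Used with `X * Y ≤ (X ^ 2 + Y ^ 2) / 2`, after which `x - y` and `z - y` are split around
    -- `m`; this produces the coefficients of `Q`.
    have key : ∀ X u s : ℝ, 0 < X → X ≤ u + 4 * s ^ 2 → X ^ 2 ≤ 2 * u ^ 2 + 32 * s ^ 4 := by
      intro X u s h1 h2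
      have : X ^ 2 ≤ (u + 4 * s ^ 2) ^ 2 := pow_le_pow_left₀ h1.le h2 2
      nlinarith [sq_nonneg (u - 4 * s ^ 2)]
    have hX2 := key X (x - y) x hX (by linarith)
    have hY2 := key Y (z - y) z hY (by linarith)
    nlinarith [sq_nonneg (X - Y), sq_nonneg (x - m + (y - m)), sq_nonneg (z - m + (y - m))])
  have hsub : uniformWeights n {w | IsLSPVia w a b c d} ≤ uniformWeights n
      {w | w e₁ ≤ ((fun w => distance w a c) - fun w => distance w b c) (raise w e₁ e₂) ∧
        w e₂ ≤ ((fun w => distance w b d) - fun w => distance w b c) (raise w e₁ e₂)} := by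
    refine measure_mono_ae (ae_uniformWeights_mem.mono fun w hw hl => ?_)
    obtain ⟨p, hp, hl⟩ := hl
    obtain ⟨-, -, ht, hd⟩ := hl
    have hph := hp.1.1
    have hpl := hp.1.2.1
    have hpe := hp.pathLength_eq
    have e1 : (a :: p ++ [d]).tail = p ++ [d] := rfl
    have e2 : (a :: p ++ [d]).dropLast = a :: p := List.dropLast_concat
    rw [e1] at ht
    rw [e2] at hd
    have hne : p ≠ [] := by rintro rfl; simp at hph
    have ht' := (IsShortestPath.of_exists (a := b) (b := d) ht
      (by rw [List.head?_append, hph]; rfl) (by simp)).pathLength_eq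
    have hd' := (IsShortestPath.of_exists (a := a) (b := c) hd rfl
      (by rw [List.getLast?_cons, hpl]; rfl)).pathLength_eq
    rw [pathLength_append_singleton w c d p hpl, hpe, edgeWeight_of_ne w hcd] at ht'
    rw [pathLength_cons_of_head? w a b hph, hpe, edgeWeight_of_ne w hab] at hd'
    have hm := distance_mono (le_raise hw e₁ e₂)
    have h1 := hm a c
    have h2 := hm b d
    constructor
    · simp only [Pi.sub_apply]; rw [hbcr]; linarith
    · simp only [Pi.sub_apply]; rw [hbcr]; linarith
  refine ENNReal.toReal_le_of_le_ofReal (by positivity) ((hsub.trans h).trans ?_)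
  rw [lintegral_add_left (by fun_prop), lintegral_add_left (by fun_prop),
    lintegral_add_left (by fun_prop), lintegral_add_left (by fun_prop),
    lintegral_const_mul _ (by fun_prop), lintegral_const_mul _ (by fun_prop),
    lintegral_const_mul _ (by fun_prop), lintegral_const_mul _ (by fun_prop),
    lintegral_const_mul _ (by fun_prop)]
  set N : ℝ := (n : ℝ) ^ 2
  calc _ ≤ 4 * (ENNReal.ofReal 2 * ENNReal.ofReal (2000000 / N) +
      ENNReal.ofReal 4 * ENNReal.ofReal (2000000 / N) +
      ENNReal.ofReal 2 * ENNReal.ofReal (2000000 / N) +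
      ENNReal.ofReal 16 * ENNReal.ofReal (497664 / N) +
      ENNReal.ofReal 16 * ENNReal.ofReal (497664 / N)) := by
        gcongr
        · exact hm a c hac
        · exact hm b c hbc
        · exact hm b d hbd
        · exact lintegral_uniform_distance_pow_four_le' hac
        · exact lintegral_uniform_distance_pow_four_le' hbd
    _ ≤ _ := by
        have hN : 0 ≤ N := by positivity
        rw [← ENNReal.ofReal_mul (by positivity), ← ENNReal.ofReal_mul (by positivity),
          ← ENNReal.ofReal_mul (by positivity), ← ENNReal.ofReal_add (by positivity)
          (by positivity), ← ENNReal.ofReal_add (by positivity) (by positivity),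
          ← ENNReal.ofReal_add (by positivity) (by positivity),
          ← ENNReal.ofReal_add (by positivity) (by positivity), ← ENNReal.ofReal_ofNat 4,
          ← ENNReal.ofReal_mul (by norm_num)]
        refine ENNReal.ofReal_le_ofReal ?_
        have : 0 ≤ 1 / N := by positivity
        have e1 : 2000000 / N = 2000000 * (1 / N) := by ring
        have e2 : 497664 / N = 497664 * (1 / N) := by ring
        rw [e1, e2]
        linarith

theorem memLp_distance (a b : Fin n) (hab : a ≠ b) :
    MemLp (fun w => distance w a b) 2 (uniformWeights n) := by
  refine MemLp.of_bound (measurable_distance a b).aestronglyMeasurable 1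
    (ae_uniformWeights_mem.mono fun w hw => ?_)
  rw [Real.norm_of_nonneg (distance_nonneg (fun e => (hw e).1) a b)]
  exact (distance_le_edge w hab).trans (hw _).2

theorem variance_distance_le {a b : Fin n} (hab : a ≠ b) :
    Var[fun w => distance w a b; uniformWeights n] ≤ 2000000 * (1 / (n : ℝ) ^ 2) := by
  obtain ⟨m, hm⟩ := exists_lintegral_uniform_distance_sub_sq_le n
  have hd := measurable_distance a b
  rw [← variance_sub_const hd.aestronglyMeasurable m]
  refine (variance_le_expectation_sq (by fun_prop)).trans ?_
  simp only [Pi.pow_apply]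
  rw [integral_eq_lintegral_of_nonneg_ae (Eventually.of_forall fun w => sq_nonneg _)
    (by fun_prop)]
  refine ENNReal.toReal_le_of_le_ofReal (by positivity) ((hm a b hab).trans ?_)
  rw [mul_one_div]

end UniformWeights

/-! ### The expected number of locally shortest paths. -/

section Counting

variable {n : ℕ}

theorem measurableSet_isShortestPath (u v : Fin n) (p : List (Fin n)) :
    MeasurableSet {w : Edge n → ℝ | IsShortestPath w u v p} := by
  have : {w : Edge n → ℝ | IsShortestPath w u v p} =
      {_w | IsPath u v p} ∩ ⋂ q : List (Fin n), ⋂ _ : IsPath u v q,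
        {w | pathLength w p ≤ pathLength w q} := by
    ext w; simp [IsShortestPath]
  rw [this]
  exact (MeasurableSet.const _).inter (MeasurableSet.iInter fun q => MeasurableSet.iInter fun _ =>
    measurableSet_le (measurable_pathLength p) (measurable_pathLength q))

theorem measurableSet_isLSP (p : List (Fin n)) :
    MeasurableSet {w : Edge n → ℝ | IsLSP w p} := by
  have h : ∀ q : List (Fin n),
      MeasurableSet {w : Edge n → ℝ | ∃ u v : Fin n, IsShortestPath w u v q} := by
    intro q
    simp only [Set.ofPred_exists]
    exact MeasurableSet.iUnion fun u => MeasurableSet.iUnion fun v =>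
      measurableSet_isShortestPath u v q
  exact (MeasurableSet.const p.Nodup).inter ((MeasurableSet.const (2 ≤ p.length)).inter
    ((h _).inter (h _)))

theorem measurableSet_isLSPVia (a b c d : Fin n) :
    MeasurableSet {w : Edge n → ℝ | IsLSPVia w a b c d} := by
  unfold IsLSPVia
  simp only [Set.ofPred_exists]
  exact MeasurableSet.iUnion fun p =>
    (measurableSet_isShortestPath b c p).inter (measurableSet_isLSP _)

theorem lspCount_eq_sum (w : Edge n → ℝ) : (lspCount w : ℝ) =
    ∑ p ∈ (nodup_finite n).toFinset, {w : Edge n → ℝ | IsLSP w p}.indicator 1 w := by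
  classical
  have h : lspSet w = ((nodup_finite n).toFinset.filter fun p => IsLSP w p : Finset _) := by
    ext p
    simp only [lspSet, Set.mem_ofPred_eq, Finset.coe_filter, Set.Finite.mem_toFinset]
    exact ⟨fun h => ⟨h.1, h⟩, fun h => h.2⟩
  rw [lspCount, h, Set.ncard_coe_finset, Finset.card_filter]
  push_cast
  refine Finset.sum_congr rfl fun p _ => ?_
  simp [Set.indicator_apply]

theorem integrable_indicator_one_uniform {s : Set (Edge n → ℝ)} (hs : MeasurableSet s) :
    Integrable (s.indicator (1 : (Edge n → ℝ) → ℝ)) (uniformWeights n) :=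
  (integrable_const (1 : ℝ)).indicator hs

theorem integrable_lspCount :
    Integrable (fun w : Edge n → ℝ => (lspCount w : ℝ)) (uniformWeights n) := by
  simp_rw [lspCount_eq_sum]
  exact integrable_finsetSum _ fun p _ => integrable_indicator_one_uniform (measurableSet_isLSP p)

theorem isShortestPath_singleton (w : Edge n → ℝ) (u : Fin n) : IsShortestPath w u u [u] := by
  refine ⟨by simp [IsPath], fun q hq => ?_⟩
  obtain ⟨h1, h2, h3⟩ := hq
  match q, h1, h2, h3 with
  | [], h1, _, _ => simp at h1
  | [x], _, _, _ => exact le_rfl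
  | x :: y :: q, h1, h2, h3 =>
    obtain rfl : x = u := by simpa using h1
    have : x ∈ y :: q := List.mem_of_getLast? (by simpa using h2)
    exact absurd this (List.nodup_cons.1 h3).1

theorem isLSP_edge (w : Edge n → ℝ) {u v : Fin n} (h : u ≠ v) : IsLSP w [u, v] :=
  ⟨by simp [h], le_rfl, ⟨v, v, isShortestPath_singleton w v⟩, ⟨u, u, isShortestPath_singleton w u⟩⟩

theorem card_edge : Fintype.card (Edge n) = n * (n - 1) := by
  rw [Fintype.card_subtype]
  have : (Finset.univ.filter fun e : Fin n × Fin n => e.1 ≠ e.2) =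
      (Finset.univ : Finset (Fin n)).offDiag := by ext; simp
  rw [this, Finset.offDiag_card]
  simp [Nat.mul_sub]

theorem le_lspCount (w : Edge n → ℝ) : n * (n - 1) ≤ lspCount w := by
  rw [← card_edge, ← Nat.card_eq_fintype_card, ← Set.ncard_univ]
  refine Set.ncard_le_ncard_of_injOn (fun e : Edge n => [e.1.1, e.1.2])
    (fun e _ => isLSP_edge w e.2) (fun e _ e' _ h => ?_) (lspSet_finite w)
  simp only [List.cons.injEq, and_true] at h
  exact Subtype.ext (Prod.ext h.1 h.2)

/-- Almost surely, different paths with the same endpoints have different lengths. -/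
theorem ae_pathLength_ne : ∀ᵐ w ∂(uniformWeights n), ∀ (u v : Fin n) (p q : List (Fin n)),
    IsPath u v p → IsPath u v q → p ≠ q → pathLength w p ≠ pathLength w q := by
  refine ae_all_iff.2 fun u => ae_all_iff.2 fun v => ae_all_iff.2 fun p => ae_all_iff.2 fun q => ?_
  by_cases h : IsPath u v p ∧ IsPath u v q ∧ p ≠ q
  · obtain ⟨hp, hq, hne⟩ := h
    -- The weight of an edge on `p` but not on `q` would be determined by the other weights.
    obtain ⟨a, b, h1, h2⟩ := exists_infix_of_ne hp.2.2 hq.2.2 hp.2.1 hq.2.1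
      (hp.1.trans hq.1.symm) hne
    have hab : a ≠ b := by
      have := hp.2.2.sublist h1.sublist
      simpa using this
    have : ∀ᵐ w ∂(uniformWeights n), pathLength w p ≠ pathLength w q := by
      rw [ae_iff]
      simp only [not_not]
      refine pi_null_of_fiber _ ⟨(a, b), hab⟩
        (measurableSet_eq_fun (measurable_pathLength p) (measurable_pathLength q)) fun w => ?_
      simp only [Set.mem_ofPred_eq]
      refine measure_mono_null (t := {pathLength w q -
        pathLength (Function.update w ⟨(a, b), hab⟩ 0) p}) (fun y hy => ?_) (measure_singleton _)
      rw [Set.mem_ofPred_eq, pathLength_update_of_infix w y p hp.2.2 h1,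
        pathLength_update_of_not_infix w y h2] at hy
      rw [Set.mem_singleton_iff]; linarith
    exact this.mono fun w hw _ _ _ => hw
  · exact Eventually.of_forall fun w h1 h2 h3 => absurd ⟨h1, h2, h3⟩ h

theorem pathLength_le_append {w : Edge n → ℝ} (hw : ∀ e, 0 ≤ w e) (p : List (Fin n)) :
    ∀ s : List (Fin n), pathLength w p ≤ pathLength w (s ++ p)
  | [] => le_rfl
  | u :: s => by
    refine (pathLength_le_append hw p s).trans ?_
    rw [List.cons_append]
    cases s ++ p with
    | nil => simp [pathLength]
    | cons v r => rw [pathLength_cons_cons]; linarith [edgeWeight_nonneg hw u v]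

/-- A competitor avoiding `a` can be extended by the edge from `a`. One that visits `a` has a final
piece from `a`, which already competes with the whole path. -/
theorem IsShortestPath.of_cons {w : Edge n → ℝ} (hw : ∀ e, 0 ≤ w e) {a b c : Fin n}
    {q : List (Fin n)} (h : IsShortestPath w a c (a :: q)) (hq : IsPath b c q) :
    IsShortestPath w b c q := by
  refine ⟨hq, fun r hr => ?_⟩
  have h1 : pathLength w (a :: q) = edgeWeight w a b + pathLength w q :=
    pathLength_cons_of_head? w a b hq.1
  by_cases ha : a ∈ r
  · obtain ⟨s, t, rfl⟩ := List.append_of_mem ha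
    have h2 := h.2 (a :: t) ⟨rfl, by simpa using hr.2.1,
      hr.2.2.sublist (List.sublist_append_right _ _)⟩
    have h3 := pathLength_le_append hw (a :: t) s
    linarith [edgeWeight_nonneg hw a b]
  · have h2 := h.2 (a :: r) ⟨rfl, by rw [List.getLast?_cons, hr.2.1]; rfl,
      List.nodup_cons.2 ⟨ha, hr.2.2⟩⟩
    rw [h1, pathLength_cons_of_head? w a b hr.1] at h2
    linarith

/-- The event that `a → b → c` is a locally shortest path with distinct vertices. -/
def tripleSet (t : Fin n × Fin n × Fin n) : Set (Edge n → ℝ) :=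
  {w | (t.1 ≠ t.2.1 ∧ t.2.1 ≠ t.2.2) ∧ IsLSP w [t.1, t.2.1, t.2.2]}

/-- The event that `a → b ⇝ c → d` is a locally shortest path with distinct vertices. -/
def quadrupleSet (t : Fin n × Fin n × Fin n × Fin n) : Set (Edge n → ℝ) :=
  {w | (t.1 ≠ t.2.1 ∧ t.1 ≠ t.2.2.1 ∧ t.2.1 ≠ t.2.2.1 ∧ t.2.1 ≠ t.2.2.2 ∧ t.2.2.1 ≠ t.2.2.2) ∧
    IsLSPVia w t.1 t.2.1 t.2.2.1 t.2.2.2}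

theorem ncard_eq_sum_indicator {ι : Type*} [Fintype ι] (s : ι → Set (Edge n → ℝ))
    (w : Edge n → ℝ) : ({t : ι | w ∈ s t}.ncard : ℝ) = ∑ t, (s t).indicator (1 : (Edge n → ℝ) → ℝ) w := by
  classical
  have : {t : ι | w ∈ s t} = (Finset.univ.filter fun t => w ∈ s t : Finset ι) := by ext; simp
  rw [this, Set.ncard_coe_finset, Finset.card_filter]
  push_cast
  refine Finset.sum_congr rfl fun t _ => ?_
  simp [Set.indicator_apply]

/-- In an LSP with at least three edges the inner part is the tail of a shortest path, hence
shortest, hence by uniqueness the chosen path `P b c`. The four outer vertices therefore determine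
it. -/
theorem lspSet_subset {w : Edge n → ℝ} (hw : ∀ e, 0 ≤ w e)
    (hu : ∀ (u v : Fin n) (p q : List (Fin n)), IsPath u v p → IsPath u v q → p ≠ q →
      pathLength w p ≠ pathLength w q) :
    ∃ P : Fin n → Fin n → List (Fin n), lspSet w ⊆
      ((fun t : Fin n × Fin n => [t.1, t.2]) '' Set.univ ∪
        (fun t : Fin n × Fin n × Fin n => [t.1, t.2.1, t.2.2]) '' {t | w ∈ tripleSet t}) ∪
        (fun t : Fin n × Fin n × Fin n × Fin n => t.1 :: P t.2.1 t.2.2.1 ++ [t.2.2.2]) ''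
          {t | w ∈ quadrupleSet t} := by
  have hex : ∀ u v : Fin n, ∃ p, IsShortestPath w u v p := by
    intro u v
    obtain ⟨p, hp, hpl⟩ := exists_isPath_pathLength_eq w u v
    exact ⟨p, hp, fun q hq => hpl ▸ distance_le_pathLength w hq⟩
  choose P hP using hex
  refine ⟨P, fun p hp => ?_⟩
  have hp' : IsLSP w p := hp
  obtain ⟨hnd, hlen, ht, hd⟩ := hp
  match p, hp', hnd, hlen, ht, hd with
  | [], _, _, hlen, _, _ => simp at hlen
  | [_], _, _, hlen, _, _ => simp at hlen
  | [a, b], _, _, _, _, _ => exact Or.inl (Or.inl ⟨(a, b), trivial, rfl⟩)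
  | [a, b, c], hl, hnd, _, _, _ =>
    refine Or.inl (Or.inr ⟨(a, b, c), ⟨⟨?_, ?_⟩, hl⟩, rfl⟩)
    · intro h; simp [show a = b from h] at hnd
    · intro h; simp [show b = c from h] at hnd
  | a :: b :: x :: y :: r, hl, hnd, _, _, hd =>
    right
    obtain ⟨q, d, hq⟩ : ∃ q d, x :: y :: r = q ++ [d] :=
      (List.eq_nil_or_concat' (x :: y :: r)).resolve_left (by simp)
    have hqne : q ≠ [] := by
      rintro rfl
      simp at hq
    obtain ⟨q', c, rfl⟩ : ∃ q' c, q = q' ++ [c] :=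
      (List.eq_nil_or_concat' q).resolve_left hqne
    have e : a :: b :: x :: y :: r = a :: (b :: (q' ++ [c])) ++ [d] := by
      rw [hq]; simp
    rw [e] at hl hnd hd ⊢
    have hsp : IsShortestPath w a c (a :: b :: (q' ++ [c])) := by
      rw [List.dropLast_concat] at hd
      refine IsShortestPath.of_exists hd rfl ?_
      rw [← List.cons_append, ← List.cons_append, List.getLast?_concat]
    have hpath : IsPath b c (b :: (q' ++ [c])) := by
      refine ⟨rfl, ?_, (List.nodup_cons.1 hsp.1.2.2).2⟩
      rw [← List.cons_append, List.getLast?_concat]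
    have hbc := hsp.of_cons hw hpath
    have hPeq : P b c = b :: (q' ++ [c]) := by
      by_contra hne
      exact hu b c _ _ (hP b c).1 hpath hne
        (le_antisymm ((hP b c).2 _ hpath) (hbc.2 _ (hP b c).1))
    refine ⟨(a, b, c, d), ⟨?_, b :: (q' ++ [c]), hbc, hl⟩, by simp only [hPeq]⟩
    have hnd' : (a :: b :: (q' ++ [c, d])).Nodup := by simpa using hnd
    simp only [List.nodup_cons, List.mem_cons, List.mem_append, List.nodup_append,
      List.not_mem_nil] at hnd'
    grind

theorem lspCount_le {w : Edge n → ℝ} (hw : ∀ e, 0 ≤ w e)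
    (hu : ∀ (u v : Fin n) (p q : List (Fin n)), IsPath u v p → IsPath u v q → p ≠ q →
      pathLength w p ≠ pathLength w q) :
    (lspCount w : ℝ) ≤ (n : ℝ) ^ 2 + ∑ t, (tripleSet t).indicator (1 : (Edge n → ℝ) → ℝ) w +
      ∑ t, (quadrupleSet t).indicator (1 : (Edge n → ℝ) → ℝ) w := by
  obtain ⟨P, hP⟩ := lspSet_subset hw hu
  rw [← ncard_eq_sum_indicator, ← ncard_eq_sum_indicator]
  have h1 : lspCount w ≤ n ^ 2 + {t | w ∈ tripleSet t}.ncard + {t | w ∈ quadrupleSet t}.ncard := by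
    refine (Set.ncard_le_ncard hP (Set.toFinite _)).trans ?_
    refine (Set.ncard_union_le _ _).trans (add_le_add ?_ (Set.ncard_image_le (Set.toFinite _)))
    refine (Set.ncard_union_le _ _).trans (add_le_add ?_ (Set.ncard_image_le (Set.toFinite _)))
    refine (Set.ncard_image_le (Set.toFinite _)).trans (le_of_eq ?_)
    rw [Set.ncard_univ, Nat.card_eq_fintype_card]; simp [sq]
  exact_mod_cast h1

theorem measurableSet_tripleSet (t : Fin n × Fin n × Fin n) : MeasurableSet (tripleSet t) :=
  (MeasurableSet.const _).inter (measurableSet_isLSP _)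

theorem measurableSet_quadrupleSet (t : Fin n × Fin n × Fin n × Fin n) :
    MeasurableSet (quadrupleSet t) :=
  (MeasurableSet.const _).inter (measurableSet_isLSPVia _ _ _ _)

theorem real_tripleSet_le (t : Fin n × Fin n × Fin n) :
    (uniformWeights n).real (tripleSet t) ≤ 300000 * (Real.log n ^ 2 / (n : ℝ) ^ 2) := by
  obtain ⟨a, b, c⟩ := t
  by_cases h : a ≠ b ∧ b ≠ c
  · exact (measureReal_mono fun w hw => hw.2).trans (prob_isLSP_triple_le h.1 h.2)
  · have : tripleSet (a, b, c) = ∅ := Set.eq_empty_of_forall_notMem fun w hw => h hw.1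
    rw [this, measureReal_empty]; positivity

theorem real_quadrupleSet_le (t : Fin n × Fin n × Fin n × Fin n) :
    (uniformWeights n).real (quadrupleSet t) ≤ 200000000 * (1 / (n : ℝ) ^ 2) := by
  obtain ⟨a, b, c, d⟩ := t
  by_cases h : a ≠ b ∧ a ≠ c ∧ b ≠ c ∧ b ≠ d ∧ c ≠ d
  · exact (measureReal_mono fun w hw => hw.2).trans
      (prob_isLSPVia_le h.1 h.2.1 h.2.2.1 h.2.2.2.1 h.2.2.2.2)
  · have : quadrupleSet (a, b, c, d) = ∅ := Set.eq_empty_of_forall_notMem fun w hw => h hw.1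
    rw [this, measureReal_empty]; positivity

theorem integral_lspCount_le (hn : 1 ≤ n) :
    ∫ w, (lspCount w : ℝ) ∂(uniformWeights n) ≤ 300000000 * (n : ℝ) ^ 2 := by
  have hn' : (1 : ℝ) ≤ n := by exact_mod_cast hn
  have hI3 : ∀ t : Fin n × Fin n × Fin n, Integrable
      ((tripleSet t).indicator (1 : (Edge n → ℝ) → ℝ)) (uniformWeights n) := fun t =>
    integrable_indicator_one_uniform (measurableSet_tripleSet t)
  have hI4 : ∀ t : Fin n × Fin n × Fin n × Fin n, Integrable
      ((quadrupleSet t).indicator (1 : (Edge n → ℝ) → ℝ)) (uniformWeights n) := fun t =>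
    integrable_indicator_one_uniform (measurableSet_quadrupleSet t)
  have hS3 := integrable_finsetSum Finset.univ fun t _ => hI3 t
  have hS4 := integrable_finsetSum Finset.univ fun t _ => hI4 t
  have hS23 : Integrable (fun w => (n : ℝ) ^ 2 +
      ∑ t, (tripleSet t).indicator (1 : (Edge n → ℝ) → ℝ) w) (uniformWeights n) :=
    (integrable_const _).add hS3
  calc ∫ w, (lspCount w : ℝ) ∂(uniformWeights n)
      ≤ ∫ w, ((n : ℝ) ^ 2 + ∑ t, (tripleSet t).indicator (1 : (Edge n → ℝ) → ℝ) w +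
        ∑ t, (quadrupleSet t).indicator (1 : (Edge n → ℝ) → ℝ) w) ∂(uniformWeights n) := by
        refine integral_mono_ae integrable_lspCount (hS23.add hS4) ?_
        filter_upwards [ae_uniformWeights_mem, ae_pathLength_ne] with w h1 h2
        exact lspCount_le (fun e => (h1 e).1) h2
    _ = (n : ℝ) ^ 2 + ∑ t, (uniformWeights n).real (tripleSet t) +
        ∑ t, (uniformWeights n).real (quadrupleSet t) := by
        rw [integral_add hS23 hS4,
          integral_add (integrable_const _) hS3, integral_finsetSum _ fun t _ => hI3 t,
          integral_finsetSum _ fun t _ => hI4 t, integral_const]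
        simp only [integral_indicator_one (measurableSet_tripleSet _),
          integral_indicator_one (measurableSet_quadrupleSet _)]
        simp
    _ ≤ (n : ℝ) ^ 2 + n ^ 3 * (300000 * (Real.log n ^ 2 / (n : ℝ) ^ 2)) +
        n ^ 4 * (200000000 * (1 / (n : ℝ) ^ 2)) := by
        have h3 := Finset.sum_le_card_nsmul Finset.univ _ _ fun t _ => real_tripleSet_le (n := n) t
        have h4 := Finset.sum_le_card_nsmul Finset.univ _ _
          fun t _ => real_quadrupleSet_le (n := n) t
        simp only [Finset.card_univ, Fintype.card_prod, Fintype.card_fin, nsmul_eq_mul] at h3 h4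
        push_cast at h3 h4
        have e3 : (n : ℝ) * (n * n) = n ^ 3 := by ring
        have e4 : (n : ℝ) * (n * (n * n)) = n ^ 4 := by ring
        rw [e3] at h3
        rw [e4] at h4
        linarith
    _ ≤ 300000000 * (n : ℝ) ^ 2 := by
        have hl := log_pow_four_le hn
        have h0 : 0 ≤ Real.log n := Real.log_nonneg hn'
        -- The paths with two edges contribute of order `n * log n ^ 2`, which this puts below `n ^
        -- 2`.
        have hl2 : Real.log n ^ 2 ≤ 4 * n := by
          refine le_of_sq_le_sq ?_ (by positivity)
          nlinarith
        have e1 : (n : ℝ) ^ 3 * (300000 * (Real.log n ^ 2 / (n : ℝ) ^ 2)) =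
            300000 * (n * Real.log n ^ 2) := by field_simp
        have e2 : (n : ℝ) ^ 4 * (200000000 * (1 / (n : ℝ) ^ 2)) = 200000000 * n ^ 2 := by
          field_simp
        rw [e1, e2]
        nlinarith

theorem le_integral_lspCount (hn : 2 ≤ n) :
    (n : ℝ) ^ 2 ≤ 2 * ∫ w, (lspCount w : ℝ) ∂(uniformWeights n) := by
  have hn' : (2 : ℝ) ≤ n := by exact_mod_cast hn
  have h : ∫ _, ((n * (n - 1) : ℕ) : ℝ) ∂(uniformWeights n) ≤
      ∫ w, (lspCount w : ℝ) ∂(uniformWeights n) :=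
    integral_mono (integrable_const _) integrable_lspCount fun w => by
      exact Nat.cast_le.2 (le_lspCount w)
  rw [integral_const, probReal_univ, one_smul, Nat.cast_mul, Nat.cast_sub (by omega)] at h
  push_cast at h
  nlinarith

theorem integral_lspCount_isTheta :
    (fun n : ℕ => ∫ w, (lspCount w : ℝ) ∂(uniformWeights n)) =Θ[atTop]
      (fun n : ℕ => (n : ℝ) ^ 2) := by
  have h0 : ∀ n : ℕ, 0 ≤ ∫ w, (lspCount w : ℝ) ∂(uniformWeights n) := fun n =>
    integral_nonneg fun w => by positivity
  constructor
  · refine IsBigO.of_bound 300000000 ((eventually_ge_atTop 1).mono fun n hn => ?_)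
    rw [Real.norm_of_nonneg (h0 n), Real.norm_of_nonneg (by positivity)]
    exact integral_lspCount_le hn
  · refine IsBigO.of_bound 2 ((eventually_ge_atTop 2).mono fun n hn => ?_)
    rw [Real.norm_of_nonneg (h0 n), Real.norm_of_nonneg (by positivity)]
    exact le_integral_lspCount hn

end Counting

end RandomAPSP

theorem mainTheorem2 :
    -- the expected number of locally shortest paths
    ((∀ n : ℕ, Integrable (fun w => (RandomAPSP.lspCount w : ℝ)) (RandomAPSP.uniformWeights n)) ∧
      (fun n : ℕ => ∫ w, (RandomAPSP.lspCount w : ℝ) ∂(RandomAPSP.uniformWeights n))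
        =Θ[atTop] (fun n : ℕ => (n : ℝ) ^ 2)) ∧
    -- paths with two edges
    (∃ C : ℝ, 0 < C ∧ ∀ (n : ℕ) (a b c : Fin n), a ≠ b → a ≠ c → b ≠ c →
      (RandomAPSP.uniformWeights n).real {w | RandomAPSP.IsLSP w [a, b, c]}
        ≤ C * (Real.log n ^ 2 / (n : ℝ) ^ 2)) ∧
    -- longer paths
    (∃ C : ℝ, 0 < C ∧ ∀ (n : ℕ) (a b c d : Fin n),
      a ≠ b → a ≠ c → a ≠ d → b ≠ c → b ≠ d → c ≠ d →
      (RandomAPSP.uniformWeights n).real {w | RandomAPSP.IsLSPVia w a b c d}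
        ≤ C * (1 / (n : ℝ) ^ 2)) ∧
    -- the variance of a distance
    (∃ C : ℝ, 0 < C ∧ ∀ (n : ℕ) (a b : Fin n), a ≠ b →
      MemLp (fun w => RandomAPSP.distance w a b) 2 (RandomAPSP.uniformWeights n) ∧
      Var[fun w => RandomAPSP.distance w a b; RandomAPSP.uniformWeights n]
        ≤ C * (1 / (n : ℝ) ^ 2)) := by
  refine ⟨⟨fun n => RandomAPSP.integrable_lspCount, RandomAPSP.integral_lspCount_isTheta⟩,
    ⟨300000, by norm_num, fun n a b c hab _ hbc => RandomAPSP.prob_isLSP_triple_le hab hbc⟩,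
    ⟨200000000, by norm_num, fun n a b c d hab hac _ hbc hbd hcd =>
      RandomAPSP.prob_isLSPVia_le hab hac hbc hbd hcd⟩,
    ⟨2000000, by norm_num, fun n a b hab =>
      ⟨RandomAPSP.memLp_distance a b hab, RandomAPSP.variance_distance_le hab⟩⟩⟩
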